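/- Let $(X,\Sigma)$ be a measurable space ($\Sigma$ a $\sigma$-algebra), and let $p(x,E)$, $x\in X$, $E\in\Sigma$, be the transition function of a Markov chain on it: $p(x,\cdot)$ is a countably additive probability measure for every $x\in X$, and $p(\cdot,E)$ is $\Sigma$-measurable for every $E\in\Sigma$. Let $ba(X,\Sigma)$ be the space of bounded finitely additive real measures on $\Sigma$, normed by the total variation $$\|\varphi\|=\sup\Big\{\sum_{i=1}^{r}|\varphi(E_i)| : E_1,\dots,E_r\in\Sigma\ \text{pairwise disjoint}\Big\},$$ and let $A\colon ba(X,\Sigma)\to ba(X,\Sigma)$ be the Markov operator $$(A\varphi)(E)=\int_X p(x,E)\,\varphi(dx),\qquad E\in\Sigma,$$ where the integral of a bounded measurable function $f$ is the limit of the integrals of simple functions that converge to $f$ uniformly. Put $S_{ba}=\{\varphi\in ba(X,\Sigma):\varphi\ge 0,\ \|\varphi\|=1\}$, let $S_{ca}$ be the set of countably additive elements of $S_{ba}$, and let $\Delta_{ba}=\{\varphi\in S_{ba}: A\varphi=\varphi\}$. For $\eta\in S_{ca}$ and $n\ge 1$ put $\lambda_n^{\eta}=\frac1n\sum_{k=1}^{n}A^k\eta$.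 A cycle of the chain is a finite family of pairwise distinct measures $\mu_1,\dots,\mu_m\in S_{ba}$, $m\ge 2$, with $A\mu_i=\mu_{i+1}$ for $1\le i<m$ and $A\mu_m=\mu_1$. An invariant measure $\mu\in\Delta_{ba}$ is called simple if it is not of the form $\frac1m\sum_{i=1}^m\mu_i$ for a cycle $\mu_1,\dots,\mu_m$. (When $\Delta_{ba}=\{\mu\}$, the mean of every cycle is $\mu$, so $\mu$ is simple if and only if the chain has no cycles.) **Theorem 5.4.** Suppose that the chain has exactly one invariant finitely additive probability measure, $\Delta_{ba}=\{\mu\}$. Then $$\|\lambda_n^{\eta}-\mu\|\to 0\quad\text{as } n\to\infty,\ \text{uniformly in } \eta\in S_{ca}.$$ If moreover $\mu$ is simple, then $$\|A^n\eta-\mu\|\to 0\quad\text{as } n\to\infty,\ \text{uniformly in } \eta\in S_{ca}.$$ -/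

import Mathlib

open MeasureTheory ProbabilityTheory Filter Topology

noncomputable section

namespace GenMarkov

variable {X : Type*} [MeasurableSpace X]

/-- The bounded finitely additive real set functions on the measurable sets of `X`, as a linear
subspace of `Set X → ℝ`. As for Mathlib's `VectorMeasure`, the value on a non-measurable set is `0`
by convention, so that two elements are equal iff they agree on all measurable sets. -/
def baSubmodule (X : Type*) [MeasurableSpace X] : Submodule ℝ (Set X → ℝ) where
  carrier := {φ | φ ∅ = 0 ∧
    (∀ E F : Set X, MeasurableSet E → MeasurableSet F → Disjoint E F →
      φ (E ∪ F) = φ E + φ F) ∧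
    (∃ C : ℝ, ∀ E : Set X, MeasurableSet E → |φ E| ≤ C) ∧
    ∀ E : Set X, ¬ MeasurableSet E → φ E = 0}
  zero_mem' := ⟨rfl, fun _ _ _ _ _ => by simp, ⟨0, fun _ _ => by simp⟩, fun _ _ => rfl⟩
  add_mem' := by
    rintro φ ψ ⟨h0, ha, ⟨C, hC⟩, hn⟩ ⟨h0', ha', ⟨C', hC'⟩, hn'⟩
    refine ⟨by simp [h0, h0'], fun E F hE hF hd => ?_, ⟨C + C', fun E hE => ?_⟩, fun E hE => ?_⟩
    · simp only [Pi.add_apply, ha E F hE hF hd, ha' E F hE hF hd]; ring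
    · exact (abs_add_le _ _).trans (add_le_add (hC E hE) (hC' E hE))
    · simp [hn E hE, hn' E hE]
  smul_mem' := by
    rintro c φ ⟨h0, ha, ⟨C, hC⟩, hn⟩
    refine ⟨by simp [h0], fun E F hE hF hd => ?_, ⟨|c| * C, fun E hE => ?_⟩, fun E hE => ?_⟩
    · simp only [Pi.smul_apply, smul_eq_mul, ha E F hE hF hd]; ring
    · simp only [Pi.smul_apply, smul_eq_mul, abs_mul]
      exact mul_le_mul_of_nonneg_left (hC E hE) (abs_nonneg c)
    · simp [hn E hE]

/-- `ba(X, Σ)`: the space of bounded finitely additive measures. -/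
def BA (X : Type*) [MeasurableSpace X] : Type _ := ↥(baSubmodule X)

namespace BA

instance : AddCommGroup (BA X) := inferInstanceAs (AddCommGroup ↥(baSubmodule X))

instance : Module ℝ (BA X) := inferInstanceAs (Module ℝ ↥(baSubmodule X))

instance : CoeFun (BA X) (fun _ => Set X → ℝ) := ⟨Subtype.val⟩

theorem ext {φ ψ : BA X} (h : ∀ E : Set X, MeasurableSet E → φ E = ψ E) : φ = ψ := by
  refine Subtype.ext (funext fun E => ?_)
  by_cases hE : MeasurableSet E
  · exact h E hE
  · rw [φ.2.2.2.2 E hE, ψ.2.2.2.2 E hE]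

@[simp] theorem add_apply (φ ψ : BA X) (E : Set X) : (φ + ψ) E = φ E + ψ E := rfl

@[simp] theorem smul_apply (c : ℝ) (φ : BA X) (E : Set X) : (c • φ) E = c * φ E := rfl

theorem apply_empty (φ : BA X) : φ ∅ = 0 := φ.2.1

theorem apply_union (φ : BA X) {E F : Set X} (hE : MeasurableSet E) (hF : MeasurableSet F)
    (h : Disjoint E F) : φ (E ∪ F) = φ E + φ F := φ.2.2.1 E F hE hF h

/-- The sums `∑ |φ(E_i)|` over finite families of pairwise disjoint measurable sets `E_i`. -/
def variationSums (φ : BA X) : Set ℝ :=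
  {r | ∃ P : Finset (Set X), (∀ E ∈ P, MeasurableSet E) ∧ (P : Set (Set X)).PairwiseDisjoint id ∧
    r = ∑ E ∈ P, |φ E|}

/-- The norm of `ba(X, Σ)`: the total variation. -/
instance : Norm (BA X) := ⟨fun φ => sSup φ.variationSums⟩

theorem apply_biUnion (φ : BA X) (P : Finset (Set X)) (hP : ∀ E ∈ P, MeasurableSet E)
    (hd : (P : Set (Set X)).PairwiseDisjoint id) : φ (⋃ E ∈ P, E) = ∑ E ∈ P, φ E := by
  classical
  induction P using Finset.induction_on with
  | empty => simpa using φ.apply_empty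
  | insert E P hE ih =>
    rw [Finset.set_biUnion_insert, Finset.sum_insert hE, apply_union φ, ih]
    · exact fun F hF => hP F (Finset.mem_insert_of_mem hF)
    · exact hd.subset (by simp)
    · exact hP E (Finset.mem_insert_self _ _)
    · exact Finset.measurableSet_biUnion _ fun F hF => hP F (Finset.mem_insert_of_mem hF)
    · rw [Set.disjoint_iUnion₂_right]
      intro F hF
      exact hd (by simp) (by simp [hF]) (fun h => hE (h ▸ hF))

theorem bddAbove_variationSums (φ : BA X) : BddAbove φ.variationSums := by
  classical
  obtain ⟨C, hC⟩ := φ.2.2.2.1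
  refine ⟨C + C, ?_⟩
  rintro r ⟨P, hP, hd, rfl⟩
  have key : ∀ Q ⊆ P, |∑ E ∈ Q, φ E| ≤ C := by
    intro Q hQ
    rw [← apply_biUnion φ Q (fun E hE => hP E (hQ hE)) (hd.subset (by exact_mod_cast hQ))]
    exact hC _ (Finset.measurableSet_biUnion _ fun F hF => hP F (hQ hF))
  rw [← Finset.sum_filter_add_sum_filter_not P (fun E => 0 ≤ φ E)]
  refine add_le_add ?_ ?_
  · rw [Finset.sum_congr rfl (g := fun E => φ E)
      (fun E hE => abs_of_nonneg (Finset.mem_filter.1 hE).2)]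
    exact (le_abs_self _).trans (key _ (Finset.filter_subset _ _))
  · rw [Finset.sum_congr rfl (g := fun E => -φ E)
      (fun E hE => abs_of_neg (not_le.1 (Finset.mem_filter.1 hE).2)), Finset.sum_neg_distrib]
    exact (neg_le_abs _).trans (key _ (Finset.filter_subset _ _))

theorem sum_abs_le_norm (φ : BA X) (P : Finset (Set X)) (hP : ∀ E ∈ P, MeasurableSet E)
    (hd : (P : Set (Set X)).PairwiseDisjoint id) : ∑ E ∈ P, |φ E| ≤ ‖φ‖ :=
  le_csSup φ.bddAbove_variationSums ⟨P, hP, hd, rfl⟩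

theorem norm_nonneg (φ : BA X) : 0 ≤ ‖φ‖ := by
  simpa using sum_abs_le_norm φ ∅ (by simp) (by simp)

/-- The integral `∑ y · φ(g = y)` of a simple function. -/
def simpleIntegral (φ : BA X) (g : SimpleFunc X ℝ) : ℝ :=
  ∑ y ∈ g.range, y * φ (g ⁻¹' {y})

/-- The filter of simple functions converging uniformly to `f`. -/
def approxFilter (f : X → ℝ) : Filter (SimpleFunc X ℝ) :=
  ⨅ ε ∈ Set.Ioi (0 : ℝ), 𝓟 {g | ∀ x, |f x - g x| ≤ ε}

/-- The integral `∫ f dφ` of a bounded measurable function `f` with respect to a bounded finitely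
additive measure: the limit of the integrals of simple functions converging uniformly to `f`. -/
def integral (φ : BA X) (f : X → ℝ) : ℝ :=
  limUnder (approxFilter f) φ.simpleIntegral

theorem simpleIntegral_eq (φ : BA X) (g : SimpleFunc X ℝ) :
    φ.simpleIntegral g
      = SimpleFunc.setToSimpleFunc (fun s => φ s • ContinuousLinearMap.id ℝ ℝ) g := by
  simp [simpleIntegral, SimpleFunc.setToSimpleFunc, mul_comm]

theorem finMeasAdditive (φ : BA X) :
    FinMeasAdditive (0 : Measure X) (fun s => φ s • ContinuousLinearMap.id ℝ ℝ) := by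
  intro s t hs ht _ _ hd
  change φ (s ∪ t) • _ = _
  rw [apply_union φ hs ht hd, add_smul]

theorem simpleIntegral_add (φ : BA X) (g h : SimpleFunc X ℝ) :
    φ.simpleIntegral (g + h) = φ.simpleIntegral g + φ.simpleIntegral h := by
  simp only [simpleIntegral_eq]
  exact SimpleFunc.setToSimpleFunc_add _ φ.finMeasAdditive (by simp) (by simp)

theorem simpleIntegral_sub (φ : BA X) (g h : SimpleFunc X ℝ) :
    φ.simpleIntegral (g - h) = φ.simpleIntegral g - φ.simpleIntegral h := by
  simp only [simpleIntegral_eq]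
  exact SimpleFunc.setToSimpleFunc_sub _ φ.finMeasAdditive (by simp) (by simp)

theorem add_simpleIntegral (φ ψ : BA X) (g : SimpleFunc X ℝ) :
    (φ + ψ).simpleIntegral g = φ.simpleIntegral g + ψ.simpleIntegral g := by
  simp [simpleIntegral, mul_add, Finset.sum_add_distrib]

theorem smul_simpleIntegral (c : ℝ) (φ : BA X) (g : SimpleFunc X ℝ) :
    (c • φ).simpleIntegral g = c * φ.simpleIntegral g := by
  simp only [simpleIntegral, smul_apply, Finset.mul_sum]
  exact Finset.sum_congr rfl fun _ _ => by ring

theorem abs_simpleIntegral_le (φ : BA X) (g : SimpleFunc X ℝ) {C : ℝ} (hC : 0 ≤ C)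
    (hg : ∀ x, |g x| ≤ C) : |φ.simpleIntegral g| ≤ C * ‖φ‖ := by
  classical
  have hinj : Set.InjOn (fun y : ℝ => (g ⁻¹' {y} : Set X)) (g.range : Set ℝ) := by
    intro y hy z _ hyz
    obtain ⟨x, rfl⟩ := SimpleFunc.mem_range.1 (Finset.mem_coe.1 hy)
    have hx : x ∈ (g ⁻¹' {g x} : Set X) := rfl
    have hx' : x ∈ (g ⁻¹' {z} : Set X) := by
      have h2 : (g ⁻¹' {g x} : Set X) = g ⁻¹' {z} := hyz
      rw [← h2]; exact hx
    exact hx'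
  calc |φ.simpleIntegral g| ≤ ∑ y ∈ g.range, |y * φ (g ⁻¹' {y})| :=
        Finset.abs_sum_le_sum_abs _ _
    _ ≤ ∑ y ∈ g.range, C * |φ (g ⁻¹' {y})| := by
        refine Finset.sum_le_sum fun y hy => ?_
        obtain ⟨x, rfl⟩ := SimpleFunc.mem_range.1 hy
        rw [abs_mul]
        exact mul_le_mul_of_nonneg_right (hg x) (abs_nonneg _)
    _ = C * ∑ E ∈ g.range.image (fun y : ℝ => (g ⁻¹' {y} : Set X)), |φ E| := by
        rw [Finset.sum_image hinj, Finset.mul_sum]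
    _ ≤ C * ‖φ‖ := by
        refine mul_le_mul_of_nonneg_left (sum_abs_le_norm φ _ ?_ ?_) hC
        · intro E hE
          obtain ⟨y, _, rfl⟩ := Finset.mem_image.1 hE
          exact g.measurableSet_preimage _
        · intro E hE F hF hne
          obtain ⟨y, _, rfl⟩ := Finset.mem_image.1 (Finset.mem_coe.1 hE)
          obtain ⟨z, _, rfl⟩ := Finset.mem_image.1 (Finset.mem_coe.1 hF)
          have hyz : y ≠ z := fun h => hne (by rw [h])
          exact Disjoint.preimage _ (Set.disjoint_singleton.2 hyz)

theorem hasBasis_approxFilter (f : X → ℝ) :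
    (approxFilter f).HasBasis (fun ε : ℝ => 0 < ε) (fun ε => {g | ∀ x, |f x - g x| ≤ ε}) := by
  refine hasBasis_biInf_principal ?_ ⟨1, Set.mem_Ioi.2 one_pos⟩
  intro a ha b hb
  exact ⟨min a b, Set.mem_Ioi.2 (lt_min ha hb), fun g hg x => (hg x).trans (min_le_left _ _),
    fun g hg x => (hg x).trans (min_le_right _ _)⟩

theorem exists_simpleFunc {f : X → ℝ} (hf : Measurable f) {C : ℝ} (hC : ∀ x, |f x| ≤ C)
    {ε : ℝ} (hε : 0 < ε) : ∃ g : SimpleFunc X ℝ, ∀ x, |f x - g x| ≤ ε := by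
  have hm : Measurable fun x => ⌊f x / ε⌋ := (hf.div_const ε).floor
  have hfin : (Set.range fun x => ⌊f x / ε⌋).Finite := by
    refine (Set.finite_Icc ⌊-C / ε⌋ ⌊C / ε⌋).subset ?_
    rintro _ ⟨x, rfl⟩
    have := abs_le.1 (hC x)
    exact ⟨Int.floor_mono (by gcongr; exact this.1), Int.floor_mono (by gcongr; exact this.2)⟩
  let g₀ : SimpleFunc X ℤ := ⟨fun x => ⌊f x / ε⌋, fun y => hm (measurableSet_singleton y), hfin⟩
  refine ⟨g₀.map fun k : ℤ => (k : ℝ) * ε, fun x => ?_⟩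
  change |f x - (⌊f x / ε⌋ : ℝ) * ε| ≤ ε
  have h1 : (⌊f x / ε⌋ : ℝ) * ε ≤ f x := (le_div_iff₀ hε).1 (Int.floor_le _)
  have h2 : f x < ((⌊f x / ε⌋ : ℝ) + 1) * ε := (div_lt_iff₀ hε).1 (Int.lt_floor_add_one _)
  rw [abs_le]
  constructor <;> linarith

/-- For bounded measurable `f` the limit defining the integral exists. -/
theorem tendsto_simpleIntegral (φ : BA X) {f : X → ℝ} (hf : Measurable f) {C : ℝ}
    (hC : ∀ x, |f x| ≤ C) :
    (approxFilter f).NeBot ∧ Tendsto φ.simpleIntegral (approxFilter f) (𝓝 (φ.integral f)) := by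
  have hne : (approxFilter f).NeBot :=
    (hasBasis_approxFilter f).neBot_iff.2 fun hε => exists_simpleFunc hf hC hε
  refine ⟨hne, ?_⟩
  have hcauchy : Cauchy (map φ.simpleIntegral (approxFilter f)) := by
    rw [Metric.cauchy_iff]
    refine ⟨hne.map _, fun ε hε => ?_⟩
    have hφ := norm_nonneg φ
    set δ : ℝ := ε / (2 * (‖φ‖ + 1)) / 2 with hδ
    have hδ0 : 0 < δ := by positivity
    refine ⟨_, image_mem_map ((hasBasis_approxFilter f).mem_of_mem hδ0), ?_⟩
    rintro _ ⟨g, hg, rfl⟩ _ ⟨h, hh, rfl⟩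
    rw [Real.dist_eq, ← simpleIntegral_sub]
    have hb : ∀ x, |(g - h) x| ≤ 2 * δ := fun x => by
      have h1 := abs_le.1 (hg x)
      have h2 := abs_le.1 (hh x)
      rw [SimpleFunc.sub_apply, abs_le]
      constructor <;> linarith
    refine (abs_simpleIntegral_le φ _ (by positivity) hb).trans_lt ?_
    have : 2 * δ * (‖φ‖ + 1) = ε / 2 := by rw [hδ]; field_simp
    nlinarith
  obtain ⟨c, hc⟩ := CompleteSpace.complete hcauchy
  exact tendsto_nhds_limUnder ⟨c, hc⟩

theorem abs_integral_sub_simpleIntegral_le (φ : BA X) {f : X → ℝ} (hf : Measurable f) {C : ℝ}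
    (hC : ∀ x, |f x| ≤ C) {g : SimpleFunc X ℝ} {ε : ℝ} (hε : 0 ≤ ε)
    (hg : ∀ x, |f x - g x| ≤ ε) : |φ.integral f - φ.simpleIntegral g| ≤ ε * ‖φ‖ := by
  obtain ⟨hne, ht⟩ := tendsto_simpleIntegral φ hf hC
  refine le_of_forall_pos_le_add fun δ hδ => ?_
  have hφ := norm_nonneg φ
  have hev : ∀ᶠ h in approxFilter f, ∀ x, |f x - h x| ≤ δ / (‖φ‖ + 1) :=
    (hasBasis_approxFilter f).mem_of_mem (by positivity)
  refine le_of_tendsto ((ht.sub_const _).abs) ?_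
  filter_upwards [hev] with h hh
  rw [← simpleIntegral_sub]
  refine (abs_simpleIntegral_le φ _ (C := ε + δ / (‖φ‖ + 1)) (by positivity) fun x => ?_).trans ?_
  · have h1 := abs_le.1 (hg x)
    have h2 := abs_le.1 (hh x)
    rw [SimpleFunc.sub_apply, abs_le]
    constructor <;> linarith
  · rw [add_mul]
    gcongr
    rw [div_mul_eq_mul_div, div_le_iff₀ (by positivity)]
    nlinarith

theorem abs_integral_le (φ : BA X) {f : X → ℝ} (hf : Measurable f) {C : ℝ} (hC0 : 0 ≤ C)
    (hC : ∀ x, |f x| ≤ C) : |φ.integral f| ≤ C * ‖φ‖ := by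
  have h := abs_integral_sub_simpleIntegral_le φ hf hC (g := 0) hC0 (fun x => by simpa using hC x)
  have h0 : φ.simpleIntegral 0 = 0 := by
    have := simpleIntegral_sub φ 0 0
    simpa using this
  simpa [h0] using h

theorem integral_add (φ : BA X) {f f' : X → ℝ} (hf : Measurable f) (hf' : Measurable f')
    {C C' : ℝ} (hC : ∀ x, |f x| ≤ C) (hC' : ∀ x, |f' x| ≤ C') :
    φ.integral (fun x => f x + f' x) = φ.integral f + φ.integral f' := by
  obtain ⟨hne, ht⟩ := tendsto_simpleIntegral φ hf hC
  obtain ⟨hne', ht'⟩ := tendsto_simpleIntegral φ hf' hC'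
  obtain ⟨-, ht''⟩ := tendsto_simpleIntegral φ (hf.add hf') (C := C + C')
    fun x => (abs_add_le _ _).trans (add_le_add (hC x) (hC' x))
  have hadd : Tendsto (fun p : SimpleFunc X ℝ × SimpleFunc X ℝ => p.1 + p.2)
      (approxFilter f ×ˢ approxFilter f') (approxFilter (f + f')) := by
    refine (((hasBasis_approxFilter f).prod (hasBasis_approxFilter f')).tendsto_iff
      (hasBasis_approxFilter _)).2 fun ε hε => ⟨(ε / 2, ε / 2), ⟨half_pos hε, half_pos hε⟩, ?_⟩
    rintro ⟨g, h⟩ ⟨hg, hh⟩ x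
    have h1 := abs_le.1 (hg x)
    have h2 := abs_le.1 (hh x)
    simp only at h1 h2
    simp only [SimpleFunc.coe_add, Pi.add_apply]
    rw [abs_le]
    constructor <;> linarith
  refine tendsto_nhds_unique (ht''.comp hadd) ?_
  refine ((ht.comp tendsto_fst).add (ht'.comp tendsto_snd)).congr fun p => ?_
  exact (simpleIntegral_add φ p.1 p.2).symm

theorem add_integral (φ ψ : BA X) {f : X → ℝ} (hf : Measurable f) {C : ℝ}
    (hC : ∀ x, |f x| ≤ C) : (φ + ψ).integral f = φ.integral f + ψ.integral f := by
  obtain ⟨hne, ht⟩ := tendsto_simpleIntegral φ hf hC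
  obtain ⟨-, ht'⟩ := tendsto_simpleIntegral ψ hf hC
  obtain ⟨-, ht''⟩ := tendsto_simpleIntegral (φ + ψ) hf hC
  exact tendsto_nhds_unique ht''
    ((ht.add ht').congr fun g => (add_simpleIntegral φ ψ g).symm)

theorem smul_integral (c : ℝ) (φ : BA X) {f : X → ℝ} (hf : Measurable f) {C : ℝ}
    (hC : ∀ x, |f x| ≤ C) : (c • φ).integral f = c * φ.integral f := by
  obtain ⟨hne, ht⟩ := tendsto_simpleIntegral φ hf hC
  obtain ⟨-, ht'⟩ := tendsto_simpleIntegral (c • φ) hf hC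
  exact tendsto_nhds_unique ht'
    ((ht.const_mul c).congr fun g => (smul_simpleIntegral c φ g).symm)

end BA

theorem measurable_kernel_real (κ : Kernel X X) {E : Set X} (hE : MeasurableSet E) :
    Measurable fun x => (κ x).real E :=
  (κ.measurable_coe hE).ennreal_toReal

theorem abs_kernel_real_le_one (κ : Kernel X X) [IsMarkovKernel κ] (E : Set X) (x : X) :
    |(κ x).real E| ≤ 1 := by
  rw [abs_of_nonneg measureReal_nonneg]
  exact measureReal_le_one

open Classical in
/-- The set function `E ↦ ∫ p(x, E) φ(dx)` on measurable sets (and `0` on the others). -/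
def markovFun (κ : Kernel X X) (φ : BA X) (E : Set X) : ℝ :=
  if MeasurableSet E then φ.integral (fun x => (κ x).real E) else 0

theorem markovFun_of_measurable (κ : Kernel X X) (φ : BA X) {E : Set X} (hE : MeasurableSet E) :
    markovFun κ φ E = φ.integral (fun x => (κ x).real E) := if_pos hE

theorem markovFun_mem (κ : Kernel X X) [IsMarkovKernel κ] (φ : BA X) :
    markovFun κ φ ∈ baSubmodule X := by
  refine ⟨?_, fun E F hE hF hd => ?_, ⟨1 * ‖φ‖, fun E hE => ?_⟩, fun E hE => if_neg hE⟩
  · rw [markovFun_of_measurable κ φ MeasurableSet.empty]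
    simpa using BA.abs_integral_le φ (f := fun x => (κ x).real ∅)
      (measurable_kernel_real κ MeasurableSet.empty) le_rfl (by simp)
  · rw [markovFun_of_measurable κ φ hE, markovFun_of_measurable κ φ hF,
      markovFun_of_measurable κ φ (hE.union hF),
      ← φ.integral_add (measurable_kernel_real κ hE) (measurable_kernel_real κ hF)
        (abs_kernel_real_le_one κ E) (abs_kernel_real_le_one κ F)]
    congr 1
    funext x
    exact measureReal_union hd hF
  · rw [markovFun_of_measurable κ φ hE]
    exact φ.abs_integral_le (measurable_kernel_real κ hE) zero_le_one
      (abs_kernel_real_le_one κ E)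

/-- The Markov operator `A` on `ba(X, Σ)` of the Markov chain with transition function
`p(x, E) = (κ x).real E`: on measurable `E`, `(A φ)(E) = ∫ p(x, E) φ(dx)`. -/
def markovOp (κ : Kernel X X) [IsMarkovKernel κ] : BA X →ₗ[ℝ] BA X where
  toFun φ := ⟨markovFun κ φ, markovFun_mem κ φ⟩
  map_add' φ ψ := BA.ext fun E hE => by
    change markovFun κ (φ + ψ) E = markovFun κ φ E + markovFun κ ψ E
    simp only [markovFun_of_measurable κ _ hE]
    exact BA.add_integral φ ψ (measurable_kernel_real κ hE) (abs_kernel_real_le_one κ E)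
  map_smul' c φ := BA.ext fun E hE => by
    change markovFun κ (c • φ) E = c * markovFun κ φ E
    simp only [markovFun_of_measurable κ _ hE]
    exact BA.smul_integral c φ (measurable_kernel_real κ hE) (abs_kernel_real_le_one κ E)

theorem markovOp_apply (κ : Kernel X X) [IsMarkovKernel κ] (φ : BA X) {E : Set X}
    (hE : MeasurableSet E) : markovOp κ φ E = φ.integral (fun x => (κ x).real E) :=
  markovFun_of_measurable κ φ hE

/-- `S_ba`: the finitely additive probability measures. -/
def Sba (X : Type*) [MeasurableSpace X] : Set (BA X) :=
  {φ | (∀ E : Set X, MeasurableSet E → 0 ≤ φ E) ∧ ‖φ‖ = 1}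

/-- Countable additivity of an element of `ba(X, Σ)`. -/
def BA.IsCountablyAdditive (φ : BA X) : Prop :=
  ∀ E : ℕ → Set X, (∀ i, MeasurableSet (E i)) → Pairwise (fun i j => Disjoint (E i) (E j)) →
    HasSum (fun i => φ (E i)) (φ (⋃ i, E i))

/-- `S_ca`: the countably additive probability measures, as elements of `ba(X, Σ)`. -/
def Sca (X : Type*) [MeasurableSpace X] : Set (BA X) :=
  {φ | φ ∈ Sba X ∧ φ.IsCountablyAdditive}

/-- `Δ_ba`: the invariant finitely additive probability measures of the chain. -/
def Deltaba (κ : Kernel X X) [IsMarkovKernel κ] : Set (BA X) :=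
  {φ | φ ∈ Sba X ∧ markovOp κ φ = φ}

/-- The Cesàro means `λ_n^η = (1/n) ∑_{k=1}^n A^k η`. -/
def cesaro (κ : Kernel X X) [IsMarkovKernel κ] (n : ℕ) (η : BA X) : BA X :=
  (1 / (n : ℝ)) • ∑ k ∈ Finset.Icc 1 n, (markovOp κ ^ k) η

/-- A cycle of period `n ≥ 2`: pairwise distinct finitely additive probability measures
`μ_1, …, μ_n` with `A μ_i = μ_{i+1}` for `i < n` and `A μ_n = μ_1`
(`finRotate n` sends `i` to `i + 1` modulo `n`). -/
structure IsCycle (κ : Kernel X X) [IsMarkovKernel κ] {n : ℕ} (c : Fin n → BA X) : Prop where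
  two_le : 2 ≤ n
  injective : Function.Injective c
  mem_Sba : ∀ i, c i ∈ Sba X
  map_eq : ∀ i, markovOp κ (c i) = c (finRotate n i)

/-- `μ` is composite: it is the mean of the measures of some cycle. -/
def IsComposite (κ : Kernel X X) [IsMarkovKernel κ] (μ : BA X) : Prop :=
  ∃ (n : ℕ) (c : Fin n → BA X), IsCycle κ c ∧ μ = (1 / (n : ℝ)) • ∑ i, c i

/-- `μ` is simple: it is not the mean of the measures of a cycle. (If `μ` is the only invariant
finitely additive probability measure, the mean of any cycle is `μ`, so this says that the chain
has no cycles.) -/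
def IsSimple (κ : Kernel X X) [IsMarkovKernel κ] (μ : BA X) : Prop :=
  ¬ IsComposite κ μ

end GenMarkov

end

open GenMarkov

/-!
Write `A` for the Markov operator, `C_n` for its Cesàro means and `P f (x) = ∫ f dκ(x)` for the
operator on bounded measurable functions that `A` is dual to. Both limits are in fact uniform over
all finitely additive initial measures.

*Cesàro means.* The finitely additive probability measures are compact for setwise convergence, and
every limit point of Cesàro means is invariant. So uniqueness of `μ` gives `C_n η (E) → μ E` for each
fixed `E`, uniformly in `η` (`exists_forall_abs_cesaro_apply_sub_lt`). Applied to a point mass, for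
which the means are countably additive, this shows by Nikodym's theorem that `μ` is a measure
(`exists_measure_of_unique`). Weak convergence of Cesàro means is norm convergence: by Mazur's theorem in
`L¹` of a dominating measure, `μ` is in the norm closed convex hull of the orbit of a point mass, and
the mean ergodic theorem gives `‖C_n δ_x - μ‖ → 0` for every `x` (`tendsto_cesaro_dirac`).
Uniformity comes from iterating the mean, in the manner of the Dunford–Pettis property: for
arbitrary sets `E_n` the functions `x ↦ C_n δ_x (E_n) - μ (E_n)` tend to `0` pointwise, hence are small off
sets decreasing to `∅`, and those have small measure under `C_n η`, uniformly in `η`. So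
`C_n C_n η (E_n) - μ (E_n) → 0` (`exists_forall_abs_cesaro_cesaro_apply_sub_le`), that is,
`C_n C_n` converges in operator norm. Long means absorb short ones, so `C_n` converges as well
(`exists_forall_norm_cesaro_sub_lt`).

*Iterates.* If there are no cycles, then `μ` is also the only invariant mean of each power of `κ`, since the
orbit of another one would be a cycle (`Deltaba_pow_eq`), and the first part applies to all
powers. On the Banach space of complex bounded measurable functions put `S f = P f - ∫ f dμ`; its
powers are `P ^ n f - ∫ f dμ`. If they did not tend to `0` in norm, then `S` would have an approximate
eigenvalue `z` of modulus one (`exists_approximate_eigenvalue`), with approximate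
eigenfunctions `f` of sup norm `1` and mean almost `0`. If `z ^ k = 1`, then `P ^ k f ≈ f`, and
convergence of the Cesàro means of `κ ^ k` makes `f` almost equal to its mean, which is absurd.
If `z` is not a root of unity, then `|f|` is close to `1` in `L¹(μ)`, so `f y ≈ z f x` for most
transitions `x → y`, and the powers satisfy `P (f ^ k) ≈ z ^ k f ^ k` in `L¹(μ)`. With `z ^ k` close
to `1` but different from it, the Cesàro means of `f ^ k` are close both to `f ^ k` and to its mean
value, which is almost `0`: again absurd (`not_forall_exists_approximate_eigenfunction`).
-/

noncomputable section

namespace GenMarkov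

variable {X : Type*} [MeasurableSpace X]

/-! ### The normed space of bounded finitely additive measures -/

namespace BA

@[simp] theorem zero_apply (E : Set X) : (0 : BA X) E = 0 := rfl

@[simp] theorem sub_apply (φ ψ : BA X) (E : Set X) : (φ - ψ) E = φ E - ψ E := rfl

theorem sum_apply {ι : Type*} (s : Finset ι) (φ : ι → BA X) (E : Set X) :
    (∑ i ∈ s, φ i) E = ∑ i ∈ s, φ i E := by
  classical
  induction s using Finset.induction_on with
  | empty => rfl
  | insert i s hi ih => rw [Finset.sum_insert hi, Finset.sum_insert hi, add_apply, ih]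

theorem abs_apply_le_norm (φ : BA X) {E : Set X} (hE : MeasurableSet E) : |φ E| ≤ ‖φ‖ := by
  simpa using sum_abs_le_norm φ {E} (by simpa using hE) (by simp)

theorem norm_le_of_forall_sum_le (φ : BA X) {C : ℝ}
    (h : ∀ P : Finset (Set X), (∀ E ∈ P, MeasurableSet E) →
      (P : Set (Set X)).PairwiseDisjoint id → ∑ E ∈ P, |φ E| ≤ C) : ‖φ‖ ≤ C := by
  refine csSup_le ⟨0, ∅, by simp, by simp, by simp⟩ ?_
  rintro r ⟨P, hP, hd, rfl⟩
  exact h P hP hd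

theorem normedSpaceCore : NormedSpace.Core ℝ (BA X) where
  norm_nonneg := norm_nonneg
  norm_smul c φ := by
    have key : ∀ (c : ℝ) (φ : BA X), ‖c • φ‖ ≤ |c| * ‖φ‖ := fun c φ =>
      norm_le_of_forall_sum_le _ fun P hP hd => by
        simp only [smul_apply, abs_mul, ← Finset.mul_sum]
        exact mul_le_mul_of_nonneg_left (sum_abs_le_norm φ P hP hd) (abs_nonneg c)
    rw [Real.norm_eq_abs]
    refine le_antisymm (key c φ) ?_
    rcases eq_or_ne c 0 with rfl | hc
    · simpa using norm_nonneg _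
    · have h := key c⁻¹ (c • φ)
      rw [smul_smul, inv_mul_cancel₀ hc, one_smul, abs_inv] at h
      rwa [← le_inv_mul_iff₀ (abs_pos.2 hc)]
  norm_triangle φ ψ := norm_le_of_forall_sum_le _ fun P hP hd =>
    calc ∑ E ∈ P, |(φ + ψ) E| ≤ ∑ E ∈ P, (|φ E| + |ψ E|) :=
          Finset.sum_le_sum fun E _ => abs_add_le _ _
      _ ≤ ‖φ‖ + ‖ψ‖ := by
          rw [Finset.sum_add_distrib]
          exact add_le_add (sum_abs_le_norm φ P hP hd) (sum_abs_le_norm ψ P hP hd)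
  norm_eq_zero_iff φ := by
    refine ⟨fun h => ext fun E hE => ?_, ?_⟩
    · exact abs_nonpos_iff.1 ((abs_apply_le_norm φ hE).trans h.le)
    · rintro rfl
      exact le_antisymm (norm_le_of_forall_sum_le _ fun P _ _ => by simp) (norm_nonneg _)

instance : NormedAddCommGroup (BA X) := NormedAddCommGroup.ofCore normedSpaceCore

instance : NormedSpace ℝ (BA X) := NormedSpace.ofCore normedSpaceCore

/-- A finitely additive measure that is small on every measurable set has small total variation:
split a disjoint family into the sets of positive and of negative measure. -/
theorem norm_le_of_forall_abs_apply_le (φ : BA X) {C : ℝ}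
    (h : ∀ E, MeasurableSet E → |φ E| ≤ C) : ‖φ‖ ≤ 2 * C := by
  classical
  refine norm_le_of_forall_sum_le φ fun P hP hd => ?_
  have key : ∀ Q ⊆ P, |∑ E ∈ Q, φ E| ≤ C := by
    intro Q hQ
    rw [← apply_biUnion φ Q (fun E hE => hP E (hQ hE)) (hd.subset (by exact_mod_cast hQ))]
    exact h _ (Finset.measurableSet_biUnion _ fun F hF => hP F (hQ hF))
  rw [← Finset.sum_filter_add_sum_filter_not P (fun E => 0 ≤ φ E), two_mul]
  refine add_le_add ?_ ?_
  · rw [Finset.sum_congr rfl (g := fun E => φ E)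
      (fun E hE => abs_of_nonneg (Finset.mem_filter.1 hE).2)]
    exact (le_abs_self _).trans (key _ (Finset.filter_subset _ _))
  · rw [Finset.sum_congr rfl (g := fun E => -φ E)
      (fun E hE => abs_of_neg (not_le.1 (Finset.mem_filter.1 hE).2)), Finset.sum_neg_distrib]
    exact (neg_le_abs _).trans (key _ (Finset.filter_subset _ _))

theorem norm_eq_apply_univ (φ : BA X) (h : ∀ E, MeasurableSet E → 0 ≤ φ E) :
    ‖φ‖ = φ Set.univ := by
  refine le_antisymm (norm_le_of_forall_sum_le _ fun P hP hd => ?_)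
    ((le_abs_self _).trans (abs_apply_le_norm φ MeasurableSet.univ))
  have hU : MeasurableSet (⋃ E ∈ P, E) := Finset.measurableSet_biUnion _ hP
  rw [Finset.sum_congr rfl (fun E hE => abs_of_nonneg (h E (hP E hE))),
    ← apply_biUnion φ P hP hd, ← Set.union_compl_self (⋃ E ∈ P, E),
    apply_union φ hU hU.compl disjoint_compl_right]
  linarith [h _ hU.compl]

end BA

theorem mem_Sba_iff {φ : BA X} :
    φ ∈ Sba X ↔ (∀ E, MeasurableSet E → 0 ≤ φ E) ∧ φ Set.univ = 1 := by
  refine and_congr_right fun h => ?_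
  rw [BA.norm_eq_apply_univ φ h]

/-! ### Bounded measurable functions and their integrals -/

/-- Bounded measurable real functions. -/
def BddMeas (f : X → ℝ) : Prop := Measurable f ∧ ∃ C, ∀ x, |f x| ≤ C

namespace BddMeas

variable {f g : X → ℝ}

theorem const (c : ℝ) : BddMeas (fun _ : X => c) := ⟨measurable_const, |c|, fun _ => le_rfl⟩

theorem add (hf : BddMeas f) (hg : BddMeas g) : BddMeas (fun x => f x + g x) := by
  obtain ⟨hf, C, hC⟩ := hf
  obtain ⟨hg, D, hD⟩ := hg
  exact ⟨hf.add hg, C + D, fun x => (abs_add_le _ _).trans (add_le_add (hC x) (hD x))⟩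

theorem const_mul (c : ℝ) (hf : BddMeas f) : BddMeas (fun x => c * f x) := by
  obtain ⟨hf, C, hC⟩ := hf
  exact ⟨hf.const_mul c, |c| * C, fun x => by
    rw [abs_mul]; exact mul_le_mul_of_nonneg_left (hC x) (abs_nonneg c)⟩

theorem sub (hf : BddMeas f) (hg : BddMeas g) : BddMeas (fun x => f x - g x) := by
  simpa [sub_eq_add_neg] using hf.add (hg.const_mul (-1))

theorem sum {ι : Type*} {s : Finset ι} {f : ι → X → ℝ} (h : ∀ i ∈ s, BddMeas (f i)) :
    BddMeas (fun x => ∑ i ∈ s, f i x) := by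
  classical
  induction s using Finset.induction_on with
  | empty => simpa using const 0
  | insert i s hi ih =>
    simp only [Finset.sum_insert hi]
    exact (h i (by simp)).add (ih fun j hj => h j (by simp [hj]))

theorem indicator {E : Set X} (hE : MeasurableSet E) (c : ℝ) :
    BddMeas (E.indicator fun _ => c) :=
  ⟨measurable_const.indicator hE, |c|, fun x => by
    by_cases hx : x ∈ E <;> simp [hx]⟩

theorem integrable (hf : BddMeas f) (m : Measure X) [IsFiniteMeasure m] : Integrable f m := by
  obtain ⟨hf, C, hC⟩ := hf
  exact Integrable.of_bound hf.aestronglyMeasurable C (ae_of_all _ hC)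

/-- Induction on bounded measurable functions: every such function is a uniform limit of finite
sums of multiples of indicator functions. -/
theorem induction {P : (X → ℝ) → Prop}
    (ind : ∀ (c : ℝ) (E : Set X), MeasurableSet E → P (E.indicator fun _ => c))
    (add : ∀ f g, BddMeas f → BddMeas g → P f → P g → P fun x => f x + g x)
    (lim : ∀ f, BddMeas f → (∀ ε > 0, ∃ g, BddMeas g ∧ P g ∧ ∀ x, |f x - g x| ≤ ε) → P f)
    (hf : BddMeas f) : P f := by
  have hs : ∀ g : SimpleFunc X ℝ, BddMeas g := fun g => by
    obtain ⟨C, hC⟩ := g.finite_range.isBounded.exists_norm_le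
    exact ⟨g.measurable, C, fun x => hC _ ⟨x, rfl⟩⟩
  have hP : ∀ g : SimpleFunc X ℝ, P g := fun g => by
    induction g using SimpleFunc.induction with
    | @const c E hE =>
      rw [SimpleFunc.coe_piecewise, SimpleFunc.coe_const, SimpleFunc.coe_const]
      convert ind c E hE using 1
      classical exact Set.piecewise_eq_indicator
    | @add g h _ hg hh => exact add g h (hs g) (hs h) hg hh
  refine lim f hf fun ε hε => ?_
  obtain ⟨hfm, C, hC⟩ := hf
  obtain ⟨g, hg⟩ := BA.exists_simpleFunc hfm hC hε
  exact ⟨g, hs g, hP g, hg⟩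

end BddMeas

namespace BA

variable {f g : X → ℝ}

theorem integral_indicator (φ : BA X) (c : ℝ) {E : Set X} (hE : MeasurableSet E) :
    φ.integral (E.indicator fun _ => c) = c * φ E := by
  classical
  let g : SimpleFunc X ℝ := SimpleFunc.piecewise E hE (SimpleFunc.const X c) (SimpleFunc.const X 0)
  have hg : (g : X → ℝ) = E.indicator fun _ => c := by
    simp [g, SimpleFunc.coe_piecewise, Set.piecewise_eq_indicator]
    rfl
  obtain ⟨hm, C, hC⟩ := BddMeas.indicator (X := X) hE c
  have h := abs_integral_sub_simpleIntegral_le φ hm hC (g := g) le_rfl (by simp [hg])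
  rw [zero_mul, abs_nonpos_iff, sub_eq_zero, simpleIntegral_eq] at h
  rw [h]
  have := SimpleFunc.setToSimpleFunc_indicator
    (fun s => φ s • ContinuousLinearMap.id ℝ ℝ) (by simp [φ.apply_empty]) (m := inferInstance) hE c
  rw [show g = _ from rfl, this]
  simp [mul_comm]

theorem integral_const (φ : BA X) (c : ℝ) : φ.integral (fun _ => c) = c * φ Set.univ := by
  simpa using φ.integral_indicator c MeasurableSet.univ

theorem integral_add' (φ : BA X) (hf : BddMeas f) (hg : BddMeas g) :
    φ.integral (fun x => f x + g x) = φ.integral f + φ.integral g := by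
  obtain ⟨hf, C, hC⟩ := hf
  obtain ⟨hg, D, hD⟩ := hg
  exact φ.integral_add hf hg hC hD

theorem abs_integral_sub_le (φ : BA X) (hf : BddMeas f) (hg : BddMeas g) {ε : ℝ} (hε : 0 ≤ ε)
    (h : ∀ x, |f x - g x| ≤ ε) : |φ.integral f - φ.integral g| ≤ ε * ‖φ‖ := by
  have h1 := φ.integral_add' (hf.sub hg) hg
  simp only [sub_add_cancel] at h1
  rw [h1, add_sub_cancel_right]
  exact φ.abs_integral_le (hf.sub hg).1 hε h

/-- A functional on bounded measurable functions that is additive, Lipschitz in the sup norm, and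
given by `φ` on multiples of indicator functions, is the integral with respect to `φ`. -/
theorem integral_eq_of_indicator (φ : BA X) (L : (X → ℝ) → ℝ) (K : ℝ)
    (ind : ∀ (c : ℝ) (E : Set X), MeasurableSet E → L (E.indicator fun _ => c) = c * φ E)
    (add : ∀ f g, BddMeas f → BddMeas g → L (fun x => f x + g x) = L f + L g)
    (lip : ∀ f g, BddMeas f → BddMeas g → ∀ ε, 0 ≤ ε → (∀ x, |f x - g x| ≤ ε) →
      |L f - L g| ≤ ε * K) (hf : BddMeas f) : φ.integral f = L f := by
  refine BddMeas.induction (P := fun f => φ.integral f = L f) (fun c E hE => ?_)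
    (fun f g hf hg h1 h2 => ?_) (fun f hf h => ?_) hf
  · rw [ind c E hE, φ.integral_indicator c hE]
  · rw [φ.integral_add' hf hg, add f g hf hg, h1, h2]
  · refine eq_of_abs_sub_le_all fun ε hε => ?_
    have hn := norm_nonneg φ
    obtain ⟨g, hg, hgL, hfg⟩ := h (ε / (‖φ‖ + |K| + 1)) (by positivity)
    have h1 := φ.abs_integral_sub_le hf hg (by positivity) hfg
    have h2 := lip f g hf hg _ (by positivity) hfg
    calc |φ.integral f - L f| = |(φ.integral f - φ.integral g) - (L f - L g)| := by
          rw [hgL]; congr 1; ring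
      _ ≤ _ := abs_sub _ _
      _ ≤ ε / (‖φ‖ + |K| + 1) * ‖φ‖ + ε / (‖φ‖ + |K| + 1) * |K| := by
          refine add_le_add h1 (h2.trans ?_)
          gcongr
          exact le_abs_self K
      _ ≤ ε := by
          rw [← mul_add, div_mul_eq_mul_div, div_le_iff₀ (by positivity)]
          nlinarith

theorem integral_const_mul (φ : BA X) (c : ℝ) (hf : BddMeas f) :
    φ.integral (fun x => c * f x) = c * φ.integral f := by
  obtain ⟨hm, C, hC⟩ := hf
  rw [← smul_integral c φ hm hC]
  symm
  refine integral_eq_of_indicator (c • φ) (fun f => φ.integral fun x => c * f x) (|c| * ‖φ‖)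
    (fun d E hE => ?_) (fun f g hf hg => ?_) (fun f g hf hg ε hε h => ?_) ⟨hm, C, hC⟩
  · have : (fun x => c * E.indicator (fun _ => d) x) = E.indicator fun _ => c * d := by
      ext x; by_cases hx : x ∈ E <;> simp [hx]
    rw [this, integral_indicator φ _ hE, smul_apply]
    ring
  · simp only [mul_add]
    exact φ.integral_add' (hf.const_mul c) (hg.const_mul c)
  · rw [← mul_assoc, mul_comm ε]
    refine φ.abs_integral_sub_le (hf.const_mul c) (hg.const_mul c) (by positivity) fun x => ?_
    rw [← mul_sub, abs_mul]
    exact mul_le_mul_of_nonneg_left (h x) (abs_nonneg c)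

theorem integral_sub (φ : BA X) (hf : BddMeas f) (hg : BddMeas g) :
    φ.integral (fun x => f x - g x) = φ.integral f - φ.integral g := by
  have h := φ.integral_add' (hf.sub hg) hg
  simp only [sub_add_cancel] at h
  linarith

theorem integral_sum (φ : BA X) {ι : Type*} {s : Finset ι} {f : ι → X → ℝ}
    (h : ∀ i ∈ s, BddMeas (f i)) :
    φ.integral (fun x => ∑ i ∈ s, f i x) = ∑ i ∈ s, φ.integral (f i) := by
  classical
  induction s using Finset.induction_on with
  | empty => simpa using φ.integral_const 0
  | insert i s hi ih =>
    simp only [Finset.sum_insert hi]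
    rw [φ.integral_add' (h i (by simp)) (.sum fun j hj => h j (by simp [hj])),
      ih fun j hj => h j (by simp [hj])]

theorem integral_nonneg (φ : BA X) (hφ : ∀ E, MeasurableSet E → 0 ≤ φ E) (hf : BddMeas f)
    (h : ∀ x, 0 ≤ f x) : 0 ≤ φ.integral f := by
  obtain ⟨hm, C, hC⟩ := hf
  rcases isEmpty_or_nonempty X with hX | ⟨⟨x₀⟩⟩
  · rw [show f = fun _ => 0 from funext fun x => hX.elim x, integral_const]; simp
  have hC0 : 0 ≤ C := (abs_nonneg _).trans (hC x₀)
  -- compare `f` with the constant `C / 2`, from which it differs by at most `C / 2`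
  have h1 := φ.abs_integral_sub_le ⟨hm, C, hC⟩ (.const (C / 2)) (ε := C / 2) (by positivity)
    fun x => by
      have h2 := abs_le.1 (hC x)
      have h3 := h x
      rw [abs_le]; constructor <;> linarith
  rw [integral_const, norm_eq_apply_univ φ hφ] at h1
  linarith [(abs_le.1 h1).1]

theorem integral_mono (φ : BA X) (hφ : ∀ E, MeasurableSet E → 0 ≤ φ E) (hf : BddMeas f)
    (hg : BddMeas g) (h : ∀ x, f x ≤ g x) : φ.integral f ≤ φ.integral g := by
  have := φ.integral_nonneg hφ (hg.sub hf) fun x => sub_nonneg.2 (h x)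
  rw [φ.integral_sub hg hf] at this
  linarith

/-- The total variation is the norm of the integral as a functional on bounded measurable
functions. -/
theorem norm_le_of_forall_integral_le (φ : BA X) {C : ℝ}
    (h : ∀ f, Measurable f → (∀ x, |f x| ≤ 1) → φ.integral f ≤ C) : ‖φ‖ ≤ C := by
  classical
  refine norm_le_of_forall_sum_le φ fun P hP hd => ?_
  let f : Set X → X → ℝ := fun E => E.indicator fun _ => (SignType.sign (φ E) : ℝ)
  have hf : ∀ E ∈ P, BddMeas (f E) := fun E hE => .indicator (hP E hE) _
  have h1 := φ.integral_sum hf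
  have h2 : ∀ E ∈ P, φ.integral (f E) = |φ E| := fun E hE => by
    rw [integral_indicator φ _ (hP E hE), sign_mul_self]
  rw [Finset.sum_congr rfl h2] at h1
  rw [← h1]
  refine h _ (BddMeas.sum hf).1 fun x => ?_
  by_cases hx : ∃ E ∈ P, x ∈ E
  · obtain ⟨E, hE, hxE⟩ := hx
    rw [Finset.sum_eq_single_of_mem E hE]
    · simp only [f, Set.indicator_of_mem hxE]
      rcases lt_trichotomy (φ E) 0 with h | h | h <;> simp [h]
    · intro F hF hne
      refine Set.indicator_of_notMem (fun hxF => ?_) _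
      exact Set.disjoint_left.1 (hd hF hE hne) hxF hxE
  · push Not at hx
    rw [Finset.sum_eq_zero fun E hE => Set.indicator_of_notMem (hx E hE) _]
    simp

theorem sub_integral (φ ψ : BA X) (hf : BddMeas f) :
    (φ - ψ).integral f = φ.integral f - ψ.integral f := by
  obtain ⟨hm, C, hC⟩ := hf
  have := add_integral (φ - ψ) ψ hm hC
  rw [sub_add_cancel] at this
  linarith

theorem sum_integral {ι : Type*} (s : Finset ι) (φ : ι → BA X) (hf : BddMeas f) :
    (∑ i ∈ s, φ i).integral f = ∑ i ∈ s, (φ i).integral f := by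
  classical
  obtain ⟨hm, C, hC⟩ := hf
  induction s using Finset.induction_on with
  | empty =>
    have := smul_integral 0 (0 : BA X) hm hC
    simpa using this
  | insert i s hi ih =>
    rw [Finset.sum_insert hi, Finset.sum_insert hi, add_integral _ _ hm hC, ih]

/-! ### Countably additive measures as elements of `BA X` -/

open Classical in
/-- A finite measure as an element of `BA X`, with the value `0` on non-measurable sets. -/
def ofMeasure (m : Measure X) [IsFiniteMeasure m] : BA X :=
  ⟨fun E => if MeasurableSet E then m.real E else 0, by
    refine ⟨by simp, fun E F hE hF hd => ?_, ⟨m.real Set.univ, fun E hE => ?_⟩,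
      fun E hE => if_neg hE⟩
    · simp only [hE, hF, hE.union hF, if_true]
      exact measureReal_union hd hF
    · simp only [hE, if_true, abs_of_nonneg measureReal_nonneg]
      exact measureReal_mono (Set.subset_univ E)⟩

theorem ofMeasure_apply (m : Measure X) [IsFiniteMeasure m] {E : Set X} (hE : MeasurableSet E) :
    ofMeasure m E = m.real E := if_pos hE

theorem ofMeasure_mem_Sba (m : Measure X) [IsProbabilityMeasure m] : ofMeasure m ∈ Sba X := by
  refine mem_Sba_iff.2 ⟨fun E hE => ?_, ?_⟩
  · rw [ofMeasure_apply m hE]; exact measureReal_nonneg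
  · rw [ofMeasure_apply m MeasurableSet.univ, probReal_univ]

theorem ofMeasure_integral (m : Measure X) [IsFiniteMeasure m] (hf : BddMeas f) :
    (ofMeasure m).integral f = ∫ x, f x ∂m := by
  refine integral_eq_of_indicator _ (fun f => ∫ x, f x ∂m) (m.real Set.univ)
    (fun c E hE => ?_) (fun f g hf hg => ?_) (fun f g hf hg ε hε h => ?_) hf
  · simp only [MeasureTheory.integral_indicator hE, setIntegral_const, ofMeasure_apply m hE]
    rw [smul_eq_mul, mul_comm]
  · exact MeasureTheory.integral_add (hf.integrable m) (hg.integrable m)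
  · rw [← MeasureTheory.integral_sub (hf.integrable m) (hg.integrable m)]
    exact norm_integral_le_of_norm_le_const (f := fun x => f x - g x) (ae_of_all _ h)

theorem exists_measure_of_isCountablyAdditive {φ : BA X} (hφ : φ ∈ Sba X)
    (hc : φ.IsCountablyAdditive) :
    ∃ (m : Measure X) (_ : IsProbabilityMeasure m), φ = ofMeasure m := by
  obtain ⟨h0, h1⟩ := mem_Sba_iff.1 hφ
  let m : Measure X := Measure.ofMeasurable (fun E _ => ENNReal.ofReal (φ E))
    (by simp [φ.apply_empty]) (fun E hE hd => by
      have h := hc E hE hd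
      rw [← h.tsum_eq, ENNReal.ofReal_tsum_of_nonneg (fun i => h0 _ (hE i)) h.summable])
  have hm : ∀ E, MeasurableSet E → m E = ENNReal.ofReal (φ E) := fun E hE =>
    Measure.ofMeasurable_apply E hE
  have hp : IsProbabilityMeasure m := ⟨by rw [hm _ MeasurableSet.univ, h1, ENNReal.ofReal_one]⟩
  refine ⟨m, hp, ext fun E hE => ?_⟩
  rw [ofMeasure_apply m hE, measureReal_def, hm E hE, ENNReal.toReal_ofReal (h0 E hE)]

end BA

/-! ### The Markov operator and its predual -/

theorem BddMeas.kernel (κ : Kernel X X) [IsMarkovKernel κ] {f : X → ℝ} (hf : BddMeas f) :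
    BddMeas fun x => ∫ y, f y ∂κ x := by
  obtain ⟨hm, C, hC⟩ := hf
  refine ⟨(hm.stronglyMeasurable.integral_kernel (κ := κ)).measurable, C, fun x => ?_⟩
  simpa using norm_integral_le_of_norm_le_const (μ := κ x) (f := f) (ae_of_all _ hC)

theorem bddMeas_kernel_real (κ : Kernel X X) [IsMarkovKernel κ] {E : Set X}
    (hE : MeasurableSet E) : BddMeas fun x => (κ x).real E :=
  ⟨measurable_kernel_real κ hE, 1, abs_kernel_real_le_one κ E⟩

/-- The Markov operator on `BA X` is dual to the operator `f ↦ ∫ f dκ(x)` on bounded measurable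
functions. -/
theorem markovOp_integral (κ : Kernel X X) [IsMarkovKernel κ] (φ : BA X) {f : X → ℝ}
    (hf : BddMeas f) : (markovOp κ φ).integral f = φ.integral fun x => ∫ y, f y ∂κ x := by
  refine BA.integral_eq_of_indicator _ (fun f => φ.integral fun x => ∫ y, f y ∂κ x) ‖φ‖
    (fun c E hE => ?_) (fun f g hf hg => ?_) (fun f g hf hg ε hε h => ?_) hf
  · simp only [MeasureTheory.integral_indicator hE, setIntegral_const, smul_eq_mul]
    rw [markovOp_apply κ φ hE, ← φ.integral_const_mul c (bddMeas_kernel_real κ hE)]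
    simp only [mul_comm]
  · simp only
    rw [← φ.integral_add' (hf.kernel κ) (hg.kernel κ)]
    congr 1
    ext x
    exact integral_add (hf.integrable _) (hg.integrable _)
  · refine φ.abs_integral_sub_le (hf.kernel κ) (hg.kernel κ) hε fun x => ?_
    rw [← integral_sub (hf.integrable _) (hg.integrable _)]
    simpa using norm_integral_le_of_norm_le_const (μ := κ x) (f := fun y => f y - g y)
      (ae_of_all _ h)

theorem norm_markovOp_le (κ : Kernel X X) [IsMarkovKernel κ] (φ : BA X) :
    ‖markovOp κ φ‖ ≤ ‖φ‖ := by
  refine BA.norm_le_of_forall_integral_le _ fun f hf h => ?_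
  rw [markovOp_integral κ φ ⟨hf, 1, h⟩]
  refine (le_abs_self _).trans ((φ.abs_integral_le (BddMeas.kernel κ ⟨hf, 1, h⟩).1 zero_le_one
    fun x => ?_).trans_eq (one_mul _))
  simpa using norm_integral_le_of_norm_le_const (μ := κ x) (f := f) (ae_of_all _ h)

theorem markovOp_mem_Sba (κ : Kernel X X) [IsMarkovKernel κ] {φ : BA X} (hφ : φ ∈ Sba X) :
    markovOp κ φ ∈ Sba X := by
  obtain ⟨h0, h1⟩ := mem_Sba_iff.1 hφ
  refine mem_Sba_iff.2 ⟨fun E hE => ?_, ?_⟩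
  · rw [markovOp_apply κ φ hE]
    exact φ.integral_nonneg h0 (bddMeas_kernel_real κ hE) fun x => measureReal_nonneg
  · rw [markovOp_apply κ φ MeasurableSet.univ]
    simp [BA.integral_const, h1]

theorem markovOp_pow_mem_Sba (κ : Kernel X X) [IsMarkovKernel κ] {φ : BA X} (hφ : φ ∈ Sba X)
    (k : ℕ) : (markovOp κ ^ k) φ ∈ Sba X := by
  induction k with
  | zero => simpa using hφ
  | succ k ih => rw [pow_succ', Module.End.mul_apply]; exact markovOp_mem_Sba κ ih

instance isMarkovKernel_pow (κ : Kernel X X) [h : IsMarkovKernel κ] (k : ℕ) :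
    IsMarkovKernel (κ ^ k) := by
  induction k with
  | zero => rw [pow_zero]; exact inferInstanceAs (IsMarkovKernel Kernel.id)
  | succ k ih => rw [pow_succ]; exact inferInstanceAs (IsMarkovKernel ((κ ^ k) ∘ₖ κ))

theorem integral_kernel_pow_succ (κ : Kernel X X) [IsMarkovKernel κ] (k : ℕ) (x : X) {E : Type*}
    [NormedAddCommGroup E] [NormedSpace ℝ E] {f : X → E} (hf : Integrable f ((κ ^ (k + 1)) x)) :
    ∫ y, f y ∂(κ ^ (k + 1)) x = ∫ z, ∫ y, f y ∂(κ ^ k) z ∂κ x := by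
  have : κ ^ (k + 1) = (κ ^ k) ∘ₖ κ := pow_succ κ k
  rw [this] at hf ⊢
  exact Kernel.integral_comp hf

theorem markovOp_pow (κ : Kernel X X) [IsMarkovKernel κ] (k : ℕ) :
    markovOp (κ ^ k) = markovOp κ ^ k := by
  induction k with
  | zero =>
    refine LinearMap.ext fun φ => BA.ext fun E hE => ?_
    rw [markovOp_apply _ φ hE]
    have : (fun x => ((κ ^ 0) x).real E) = E.indicator fun _ => (1 : ℝ) := by
      ext x
      rw [pow_zero, show (1 : Kernel X X) = Kernel.id from rfl, Kernel.id_apply, measureReal_def,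
        Measure.dirac_apply' x hE]
      by_cases hx : x ∈ E <;> simp [hx]
    rw [this, φ.integral_indicator 1 hE, one_mul]
    rfl
  | succ k ih =>
    refine LinearMap.ext fun φ => BA.ext fun E hE => ?_
    rw [markovOp_apply _ φ hE, pow_succ (markovOp κ), Module.End.mul_apply, ← ih,
      markovOp_apply _ _ hE, markovOp_integral κ φ (bddMeas_kernel_real _ hE)]
    congr 1
    ext x
    have h := integral_kernel_pow_succ κ k x (f := E.indicator fun _ => (1 : ℝ))
      ((BddMeas.indicator hE 1).integrable _)
    simpa [MeasureTheory.integral_indicator hE] using h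

theorem markovOp_pow_apply (κ : Kernel X X) [IsMarkovKernel κ] (k : ℕ) (φ : BA X) {E : Set X}
    (hE : MeasurableSet E) :
    (markovOp κ ^ k) φ E = φ.integral fun x => ((κ ^ k) x).real E := by
  rw [← markovOp_pow, markovOp_apply _ φ hE]

theorem markovOp_pow_dirac (κ : Kernel X X) [IsMarkovKernel κ] (k : ℕ) (x : X) :
    (markovOp κ ^ k) (BA.ofMeasure (Measure.dirac x)) = BA.ofMeasure ((κ ^ k) x) := by
  refine BA.ext fun E hE => ?_
  rw [markovOp_pow_apply κ k _ hE, BA.ofMeasure_integral _ (bddMeas_kernel_real _ hE),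
    BA.ofMeasure_apply _ hE, integral_dirac' _ _ (measurable_kernel_real _ hE).stronglyMeasurable]

end GenMarkov

end

noncomputable section

/-! ### Cesàro means of a contraction -/

section MeanErgodic

variable {V : Type*} [NormedAddCommGroup V] [NormedSpace ℝ V]

/-- The Cesàro mean `(1/n) ∑_{k=1}^n A^k` of a linear map (`0` for `n = 0`). -/
def meanOp (A : V →ₗ[ℝ] V) (n : ℕ) : V →ₗ[ℝ] V :=
  (1 / (n : ℝ)) • ∑ k ∈ Finset.Icc 1 n, A ^ k

variable {A : V →ₗ[ℝ] V}

theorem meanOp_apply (A : V →ₗ[ℝ] V) (n : ℕ) (v : V) :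
    meanOp A n v = (1 / (n : ℝ)) • ∑ k ∈ Finset.Icc 1 n, (A ^ k) v := by
  simp [meanOp]

theorem norm_pow_apply_le (hA : ∀ v, ‖A v‖ ≤ ‖v‖) (k : ℕ) (v : V) : ‖(A ^ k) v‖ ≤ ‖v‖ := by
  induction k with
  | zero => simp
  | succ k ih => rw [pow_succ', Module.End.mul_apply]; exact (hA _).trans ih

theorem pow_apply_eq_self {v : V} (hv : A v = v) (k : ℕ) : (A ^ k) v = v := by
  induction k with
  | zero => simp
  | succ k ih => rw [pow_succ, Module.End.mul_apply, hv, ih]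

theorem norm_average_sub_le {n : ℕ} (hn : 1 ≤ n) (v : ℕ → V) {w : V} {C : ℝ}
    (h : ∀ k ∈ Finset.Icc 1 n, ‖v k - w‖ ≤ C) :
    ‖(1 / (n : ℝ)) • ∑ k ∈ Finset.Icc 1 n, v k - w‖ ≤ C := by
  have hn' : (0 : ℝ) < n := by exact_mod_cast hn
  have : (1 / (n : ℝ)) • ∑ k ∈ Finset.Icc 1 n, v k - w
      = (1 / (n : ℝ)) • ∑ k ∈ Finset.Icc 1 n, (v k - w) := by
    rw [Finset.sum_sub_distrib, smul_sub, Finset.sum_const, Nat.card_Icc,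
      Nat.add_sub_cancel, ← Nat.cast_smul_eq_nsmul ℝ, smul_smul, one_div,
      inv_mul_cancel₀ hn'.ne', one_smul]
  rw [this, norm_smul, Real.norm_eq_abs, abs_of_pos (by positivity), one_div,
    inv_mul_le_iff₀ hn']
  refine (norm_sum_le_of_le _ h).trans ?_
  simp

theorem norm_meanOp_sub_le (n : ℕ) {v w : V} {C : ℝ}
    (h : ∀ k ∈ Finset.Icc 1 n, ‖(A ^ k) v - w‖ ≤ C) (hn : 1 ≤ n) : ‖meanOp A n v - w‖ ≤ C := by
  rw [meanOp_apply]
  exact norm_average_sub_le hn _ h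

theorem norm_meanOp_le (hA : ∀ v, ‖A v‖ ≤ ‖v‖) (n : ℕ) (v : V) : ‖meanOp A n v‖ ≤ ‖v‖ := by
  rcases Nat.eq_zero_or_pos n with rfl | hn
  · simp [meanOp_apply]
  · simpa using norm_meanOp_sub_le (A := A) n (w := 0)
      (fun k _ => by simpa using norm_pow_apply_le hA k v) hn

theorem meanOp_eq_self {v : V} (hv : A v = v) {n : ℕ} (hn : 1 ≤ n) : meanOp A n v = v := by
  rw [← sub_eq_zero, ← norm_le_zero_iff]
  exact norm_meanOp_sub_le n (fun k _ => by simp [pow_apply_eq_self hv]) hn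

theorem commute_meanOp_pow (A : V →ₗ[ℝ] V) (n k : ℕ) : Commute (meanOp A n) (A ^ k) :=
  (Commute.sum_left _ _ _ fun _ _ => Commute.pow_pow_self A _ _).smul_left _

theorem commute_meanOp (A : V →ₗ[ℝ] V) (m n : ℕ) : Commute (meanOp A m) (meanOp A n) :=
  (Commute.sum_right _ _ _ fun k _ => commute_meanOp_pow A m k).smul_right _

theorem map_meanOp_sub (A : V →ₗ[ℝ] V) (n : ℕ) (v : V) :
    A (meanOp A n v) - meanOp A n v = (1 / (n : ℝ)) • ((A ^ (n + 1)) v - A v) := by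
  have h : A (∑ k ∈ Finset.Icc 1 n, (A ^ k) v) - ∑ k ∈ Finset.Icc 1 n, (A ^ k) v
      = (A ^ (n + 1)) v - A v := by
    induction n with
    | zero => simp
    | succ n ih =>
      rw [Finset.sum_Icc_succ_top (by omega), map_add, add_sub_add_comm, ih,
        pow_succ' A (n + 1), Module.End.mul_apply]
      abel
  rw [meanOp_apply, map_smul, ← smul_sub, h]

theorem norm_map_meanOp_sub_le (hA : ∀ v, ‖A v‖ ≤ ‖v‖) (n : ℕ) (v : V) :
    ‖A (meanOp A n v) - meanOp A n v‖ ≤ 2 / n * ‖v‖ := by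
  rw [map_meanOp_sub, norm_smul, Real.norm_eq_abs, abs_of_nonneg (by positivity)]
  calc 1 / (n : ℝ) * ‖(A ^ (n + 1)) v - A v‖ ≤ 1 / n * (‖v‖ + ‖v‖) := by
        gcongr
        exact (norm_sub_le _ _).trans (add_le_add (norm_pow_apply_le hA _ v) (hA v))
    _ = _ := by ring

theorem norm_meanOp_pow_sub_le (hA : ∀ v, ‖A v‖ ≤ ‖v‖) (n k : ℕ) (v : V) :
    ‖meanOp A n ((A ^ k) v) - meanOp A n v‖ ≤ 2 * k / n * ‖v‖ := by
  have hc : ∀ w, meanOp A n (A w) = A (meanOp A n w) := fun w => by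
    simpa using LinearMap.congr_fun (commute_meanOp_pow A n 1) w
  induction k with
  | zero => simp
  | succ k ih =>
    have h1 := norm_map_meanOp_sub_le hA n ((A ^ k) v)
    rw [← hc] at h1
    rw [pow_succ', Module.End.mul_apply]
    calc _ ≤ _ := norm_sub_le_norm_sub_add_norm_sub _ (meanOp A n ((A ^ k) v)) _
      _ ≤ 2 / n * ‖v‖ + 2 * k / n * ‖v‖ := by
          refine add_le_add (h1.trans ?_) ih
          gcongr
          exact norm_pow_apply_le hA k v
      _ = _ := by push_cast; ring

/-- Long means absorb short ones. -/
theorem norm_meanOp_meanOp_sub_le (hA : ∀ v, ‖A v‖ ≤ ‖v‖) (N : ℕ) {n : ℕ} (hn : 1 ≤ n) (v : V) :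
    ‖meanOp A N (meanOp A n v) - meanOp A N v‖ ≤ 2 * n / N * ‖v‖ := by
  have hc : meanOp A N (meanOp A n v) = meanOp A n (meanOp A N v) :=
    LinearMap.congr_fun (commute_meanOp A N n) v
  rw [hc]
  refine norm_meanOp_sub_le n (fun k hk => ?_) hn
  have : (A ^ k) (meanOp A N v) = meanOp A N ((A ^ k) v) :=
    (LinearMap.congr_fun (commute_meanOp_pow A N k) v).symm
  rw [this]
  refine (norm_meanOp_pow_sub_le hA N k v).trans ?_
  gcongr
  exact (Finset.mem_Icc.1 hk).2

/-- The mean ergodic theorem: if the closed convex hull of the orbit of `v` contains a fixed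
point `w`, then the Cesàro means of `v` converge to `w`. -/
theorem tendsto_meanOp_of_mem_closure_convexHull (hA : ∀ v, ‖A v‖ ≤ ‖v‖) {v w : V}
    (hw : A w = w) (hvw : w ∈ closure (convexHull ℝ (Set.range fun k : ℕ => (A ^ k) v))) :
    Tendsto (fun n => meanOp A n v) atTop (𝓝 w) := by
  -- the vectors whose means are asymptotic to those of `v` form a convex set
  let S : Set V := {u | Tendsto (fun n => meanOp A n u - meanOp A n v) atTop (𝓝 0)}
  have hS : Convex ℝ S := by
    intro a ha b hb s t _ _ hst
    have h := (Tendsto.const_smul ha s).add (Tendsto.const_smul hb t)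
    rw [smul_zero, smul_zero, add_zero] at h
    refine h.congr fun n => ?_
    rw [map_add, map_smul, map_smul, smul_sub, smul_sub, sub_add_sub_comm, ← add_smul, hst,
      one_smul]
  have hsub : convexHull ℝ (Set.range fun k : ℕ => (A ^ k) v) ⊆ S := by
    refine convexHull_min ?_ hS
    rintro _ ⟨k, rfl⟩
    refine squeeze_zero_norm (norm_meanOp_pow_sub_le hA · k v) ?_
    have : Tendsto (fun n : ℕ => 2 * (k : ℝ) / n * ‖v‖) atTop (𝓝 (0 * ‖v‖)) :=
      (tendsto_const_div_atTop_nhds_zero_nat _).mul_const _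
    simpa using this
  rw [Metric.tendsto_atTop]
  intro ε hε
  obtain ⟨u, hu, hwu⟩ := Metric.mem_closure_iff.1 hvw (ε / 2) (half_pos hε)
  obtain ⟨N, hN⟩ := Metric.tendsto_atTop.1 (hsub hu) (ε / 2) (half_pos hε)
  refine ⟨max N 1, fun n hn => ?_⟩
  have h1 := hN n ((le_max_left _ _).trans hn)
  rw [dist_zero_right] at h1
  have h2 : ‖meanOp A n u - w‖ < ε / 2 := by
    rw [← meanOp_eq_self hw ((le_max_right _ _).trans hn), ← map_sub]
    rw [dist_comm, dist_eq_norm] at hwu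
    exact (norm_meanOp_le hA n _).trans_lt hwu
  rw [dist_eq_norm]
  calc ‖meanOp A n v - w‖ = ‖(meanOp A n u - w) - (meanOp A n u - meanOp A n v)‖ := by
        congr 1; abel
    _ ≤ _ := norm_sub_le _ _
    _ < ε := by linarith

end MeanErgodic

namespace GenMarkov

variable {X : Type*} [MeasurableSpace X]

theorem cesaro_eq_meanOp (κ : Kernel X X) [IsMarkovKernel κ] (n : ℕ) (η : BA X) :
    cesaro κ n η = meanOp (markovOp κ) n η := (meanOp_apply _ n η).symm

theorem Sba_convex : Convex ℝ (Sba X) := by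
  intro φ hφ ψ hψ s t hs ht hst
  obtain ⟨h0, h1⟩ := mem_Sba_iff.1 hφ
  obtain ⟨h0', h1'⟩ := mem_Sba_iff.1 hψ
  refine mem_Sba_iff.2 ⟨fun E hE => ?_, ?_⟩
  · have := h0 E hE
    have := h0' E hE
    rw [BA.add_apply, BA.smul_apply, BA.smul_apply]
    positivity
  · rw [BA.add_apply, BA.smul_apply, BA.smul_apply, h1, h1', mul_one, mul_one, hst]

theorem cesaro_mem_Sba (κ : Kernel X X) [IsMarkovKernel κ] {n : ℕ} (hn : 1 ≤ n) {η : BA X}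
    (hη : η ∈ Sba X) : cesaro κ n η ∈ Sba X := by
  have hn' : (n : ℝ) ≠ 0 := by exact_mod_cast (by omega : n ≠ 0)
  rw [cesaro, Finset.smul_sum]
  refine Sba_convex.sum_mem (fun _ _ => by positivity) ?_
    fun k _ => markovOp_pow_mem_Sba κ hη k
  simp [hn']

/-! ### Compactness, and setwise convergence of the Cesàro means -/

theorem tendsto_integral_of_setwise {ι : Type*} {l : Filter ι} {φ : ι → BA X}
    (hφ : ∀ i, φ i ∈ Sba X) {ν : BA X} (hν : ν ∈ Sba X)
    (hlim : ∀ E, MeasurableSet E → Tendsto (fun i => φ i E) l (𝓝 (ν E)))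
    {f : X → ℝ} (hf : BddMeas f) :
    Tendsto (fun i => (φ i).integral f) l (𝓝 (ν.integral f)) := by
  refine BddMeas.induction (P := fun f => Tendsto (fun i => (φ i).integral f) l
    (𝓝 (ν.integral f))) (fun c E hE => ?_) (fun f g hf hg h1 h2 => ?_) (fun f hf h => ?_) hf
  · simp only [BA.integral_indicator _ c hE]
    exact (hlim E hE).const_mul c
  · simp only [BA.integral_add' _ hf hg]
    exact h1.add h2
  · rw [Metric.tendsto_nhds]
    intro ε hε
    obtain ⟨g, hg, hgl, hfg⟩ := h (ε / 4) (by positivity)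
    filter_upwards [Metric.tendsto_nhds.1 hgl (ε / 4) (by positivity)] with i hi
    have h1 := (φ i).abs_integral_sub_le hf hg (by positivity) hfg
    have h2 := ν.abs_integral_sub_le hf hg (by positivity) hfg
    rw [(hφ i).2, mul_one] at h1
    rw [hν.2, mul_one] at h2
    rw [Real.dist_eq] at hi ⊢
    have h1 := abs_le.1 h1
    have h2 := abs_le.1 h2
    have hi := abs_lt.1 hi
    rw [abs_lt]
    constructor <;> linarith

/-- Every family of finitely additive probability measures has a limit along every ultrafilter. -/
theorem exists_ultrafilter_limit {ι : Type*} (U : Ultrafilter ι) (φ : ι → BA X)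
    (hφ : ∀ i, φ i ∈ Sba X) :
    ∃ ν ∈ Sba X, ∀ f, BddMeas f → Tendsto (fun i => (φ i).integral f) U (𝓝 (ν.integral f)) := by
  have hb : ∀ i (E : Set X), φ i E ∈ Set.Icc (0 : ℝ) 1 := fun i E => by
    by_cases hE : MeasurableSet E
    · exact ⟨(hφ i).1 E hE,
        (le_abs_self _).trans ((BA.abs_apply_le_norm _ hE).trans_eq (hφ i).2)⟩
    · rw [(φ i).2.2.2.2 E hE]; simp
  have hex : ∀ E : Set X, ∃ c ∈ Set.Icc (0 : ℝ) 1, Tendsto (fun i => φ i E) U (𝓝 c) := fun E =>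
    isCompact_Icc.ultrafilter_le_nhds' (U.map fun i => φ i E)
      (Filter.mem_map.2 (Filter.univ_mem' fun i => hb i E))
  choose v hv hlim using hex
  let ν : BA X := ⟨v, by
    refine ⟨?_, fun E F hE hF hd => ?_, ⟨1, fun E _ => ?_⟩, fun E hE => ?_⟩
    · refine tendsto_nhds_unique (hlim ∅) ?_
      simp [BA.apply_empty]
    · refine tendsto_nhds_unique (hlim (E ∪ F)) (((hlim E).add (hlim F)).congr fun i => ?_)
      rw [(φ i).apply_union hE hF hd]
    · rw [abs_of_nonneg (hv E).1]; exact (hv E).2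
    · refine tendsto_nhds_unique (hlim E) (tendsto_const_nhds.congr fun i => ?_)
      exact ((φ i).2.2.2.2 E hE).symm⟩
  have hν : ν ∈ Sba X := by
    refine mem_Sba_iff.2 ⟨fun E _ => (hv E).1, tendsto_nhds_unique (hlim Set.univ) ?_⟩
    exact tendsto_const_nhds.congr fun i => ((mem_Sba_iff.1 (hφ i)).2).symm
  exact ⟨ν, hν, fun f hf => tendsto_integral_of_setwise hφ hν (fun E _ => hlim E) hf⟩

variable {κ : Kernel X X} [IsMarkovKernel κ] {μ : BA X}

/-- Uniqueness of the invariant mean forces the Cesàro means to converge to it on each measurable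
set, uniformly over all initial measures: a limit point of a bad sequence of Cesàro means would be
another invariant mean. -/
theorem exists_forall_abs_cesaro_apply_sub_lt (hμ : Deltaba κ = {μ}) {E : Set X}
    (hE : MeasurableSet E) {ε : ℝ} (hε : 0 < ε) :
    ∃ N : ℕ, ∀ n, N ≤ n → ∀ η ∈ Sba X, |cesaro κ n η E - μ E| < ε := by
  by_contra! hcon
  choose n hn η hη hbad using fun N => hcon (N + 1)
  have hmem : ∀ N, cesaro κ (n N) (η N) ∈ Sba X := fun N =>
    cesaro_mem_Sba κ (by have := hn N; omega) (hη N)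
  let U : Ultrafilter ℕ := Ultrafilter.of atTop
  have hU : (U : Filter ℕ) ≤ atTop := Ultrafilter.of_le atTop
  obtain ⟨ν, hν, hlim⟩ := exists_ultrafilter_limit U _ hmem
  have happ : ∀ F, MeasurableSet F →
      Tendsto (fun N => cesaro κ (n N) (η N) F) U (𝓝 (ν F)) := fun F hF => by
    simpa [BA.integral_indicator _ 1 hF] using hlim _ (.indicator hF 1)
  have hinv : markovOp κ ν = ν := by
    refine BA.ext fun F hF => ?_
    have h1 := hlim _ (bddMeas_kernel_real κ hF)
    have h2 := h1.sub (happ F hF)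
    rw [← markovOp_apply κ ν hF] at h2
    rw [← sub_eq_zero]
    refine tendsto_nhds_unique h2 (Tendsto.mono_left ?_ hU)
    refine squeeze_zero_norm (a := fun N : ℕ => 2 / ((N + 1 : ℕ) : ℝ)) (fun N => ?_)
      ((tendsto_const_div_atTop_nhds_zero_nat 2).comp (tendsto_add_atTop_nat 1))
    rw [← markovOp_apply κ _ hF, ← BA.sub_apply, Real.norm_eq_abs]
    refine (BA.abs_apply_le_norm _ hF).trans ?_
    rw [cesaro_eq_meanOp]
    refine (norm_map_meanOp_sub_le (norm_markovOp_le κ) _ _).trans ?_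
    rw [(hη N).2, mul_one]
    have : ((N + 1 : ℕ) : ℝ) ≤ n N := by exact_mod_cast hn N
    gcongr
  have heq : ν = μ := by
    have : ν ∈ Deltaba κ := ⟨hν, hinv⟩
    rwa [hμ] at this
  have h3 : Tendsto (fun N => |cesaro κ (n N) (η N) E - μ E|) U (𝓝 0) := by
    have := ((happ E hE).sub_const (μ E)).abs
    rwa [heq, sub_self, abs_zero] at this
  exact absurd (ge_of_tendsto' h3 hbad) (not_le.2 hε)

end GenMarkov

end

noncomputable section

namespace GenMarkov

variable {X : Type*} [MeasurableSpace X]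

/-! ### Nikodym's convergence theorem -/

/-- Continuity from above of a finitely additive setwise limit of probability measures. If it
failed along a decreasing sequence `E`, a gliding hump would produce a set on which
the approximating measures oscillate. -/
theorem tendsto_apply_zero_of_setwise_limit {m : ℕ → Measure X}
    [∀ n, IsProbabilityMeasure (m n)] {φ : BA X} (hφ : φ ∈ Sba X)
    (hlim : ∀ E, MeasurableSet E → Tendsto (fun n => (m n).real E) atTop (𝓝 (φ E)))
    {E : ℕ → Set X} (hE : ∀ i, MeasurableSet (E i)) (hanti : Antitone E)
    (hempty : ⋂ i, E i = ∅) : Tendsto (fun i => φ (E i)) atTop (𝓝 0) := by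
  have hmono : Antitone fun i => φ (E i) := fun i j hij =>
    le_of_tendsto_of_tendsto' (hlim _ (hE j)) (hlim _ (hE i)) fun n =>
      measureReal_mono (hanti hij)
  have hbdd : BddBelow (Set.range fun i => φ (E i)) :=
    ⟨0, by rintro _ ⟨i, rfl⟩; exact hφ.1 _ (hE i)⟩
  set c := ⨅ i, φ (E i) with hc
  have hconv : Tendsto (fun i => φ (E i)) atTop (𝓝 c) := tendsto_atTop_ciInf hmono hbdd
  have hcle : ∀ i, c ≤ φ (E i) := fun i => ciInf_le hbdd i
  have hc0 : 0 ≤ c := le_ciInf fun i => hφ.1 _ (hE i)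
  rcases hc0.eq_or_lt with h0 | hcpos
  · rwa [← h0] at hconv
  exfalso
  set δ := c / 10 with hδ
  have hδ0 : 0 < δ := by positivity
  obtain ⟨i₀, hi₀⟩ := ((tendsto_order.1 hconv).2 (c + δ) (by linarith)).exists
  have hstep : ∀ i, ∃ n j, i ≤ n ∧ i < j ∧ (i₀ ≤ i →
      (m n).real (E i₀ \ E i) < 2 * δ ∧ c - δ < (m n).real (E i)) ∧ (m n).real (E j) < δ := by
    intro i
    have h1 : ∀ᶠ n in atTop, i₀ ≤ i → (m n).real (E i₀ \ E i) < 2 * δ := by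
      by_cases hi : i₀ ≤ i
      · have hd : φ (E i₀ \ E i) = φ (E i₀) - φ (E i) := by
          have := φ.apply_union ((hE i₀).diff (hE i)) (hE i) Set.disjoint_sdiff_left
          rw [Set.sdiff_union_of_subset (hanti hi)] at this
          linarith
        have := (tendsto_order.1 (hlim _ ((hE i₀).diff (hE i)))).2 (2 * δ)
          (by rw [hd]; linarith [hcle i])
        exact this.mono fun _ h _ => h
      · exact Eventually.of_forall fun _ h => absurd h hi
    have h2 := (tendsto_order.1 (hlim _ (hE i))).1 (c - δ) (by linarith [hcle i])
    obtain ⟨n, hn1, hn2, hn⟩ := (h1.and (h2.and (eventually_ge_atTop i))).exists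
    have h3 : Tendsto (fun j => (m n).real (E j)) atTop (𝓝 0) := by
      have := tendsto_measure_iInter_atTop (μ := m n) (fun j => (hE j).nullMeasurableSet) hanti
        ⟨0, measure_ne_top _ _⟩
      rw [hempty, measure_empty] at this
      exact (ENNReal.tendsto_toReal ENNReal.zero_ne_top).comp this
    obtain ⟨j, hj, hij⟩ :=
      (((tendsto_order.1 h3).2 δ hδ0).and (eventually_gt_atTop i)).exists
    exact ⟨n, j, hn, hij, fun hi => ⟨hn1 hi, hn2⟩, hj⟩
  choose n j hin hij hbig hsmall using hstep
  let a : ℕ → ℕ := fun k => j^[k] i₀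
  have ha : ∀ k, a (k + 1) = j (a k) := fun k => Function.iterate_succ_apply' j k i₀
  have hamono : StrictMono a := strictMono_nat_of_lt_succ fun k => by rw [ha]; exact hij _
  have ha0 : ∀ k, i₀ ≤ a k := fun k => hamono.monotone (Nat.zero_le k)
  let F : Set X := ⋃ k, E (a (2 * k)) \ E (a (2 * k + 1))
  have hF : MeasurableSet F := MeasurableSet.iUnion fun k => (hE _).diff (hE _)
  have hsub : ∀ f : ℕ → ℕ, StrictMono f → Tendsto (fun k => (m (n (a (f k)))).real F) atTop
      (𝓝 (φ F)) := fun f hf => by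
    refine (hlim F hF).comp (tendsto_atTop_mono (fun k => ?_) tendsto_id)
    exact (hf.id_le k).trans ((hamono.id_le _).trans (hin _))
  have hlow : c - 2 * δ ≤ φ F := by
    refine ge_of_tendsto' (hsub (fun k => 2 * k) fun x y h => by dsimp; omega) fun k => ?_
    have h1 := (hbig (a (2 * k)) (ha0 _)).2
    have h2 := hsmall (a (2 * k))
    rw [← ha] at h2
    have h3 : (m (n (a (2 * k)))).real (E (a (2 * k))) ≤ (m (n (a (2 * k)))).real F +
        (m (n (a (2 * k)))).real (E (a (2 * k + 1))) := by
      refine (measureReal_mono (fun x hx => ?_)).trans (measureReal_union_le _ _)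
      by_cases hx' : x ∈ E (a (2 * k + 1))
      · exact Or.inr hx'
      · exact Or.inl (Set.mem_iUnion.2 ⟨k, hx, hx'⟩)
    linarith
  have hup : φ F ≤ 3 * δ := by
    refine le_of_tendsto' (hsub (fun k => 2 * k + 1) fun x y h => by dsimp; omega) fun k => ?_
    have h1 := (hbig (a (2 * k + 1)) (ha0 _)).1
    have h2 := hsmall (a (2 * k + 1))
    rw [← ha] at h2
    have h3 : (m (n (a (2 * k + 1)))).real F ≤
        (m (n (a (2 * k + 1)))).real (E i₀ \ E (a (2 * k + 1))) +
        (m (n (a (2 * k + 1)))).real (E (a (2 * k + 1 + 1))) := by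
      refine (measureReal_mono (fun x hx => ?_)).trans (measureReal_union_le _ _)
      obtain ⟨l, hl, hl'⟩ := Set.mem_iUnion.1 hx
      rcases Nat.lt_or_ge k l with hkl | hkl
      · exact Or.inr (hanti (hamono.monotone (by omega)) hl)
      · exact Or.inl ⟨hanti (ha0 _) hl, fun h => hl' (hanti (hamono.monotone (by omega)) h)⟩
    linarith
  linarith

/-- **Nikodym's convergence theorem** for probability measures: a setwise limit is countably
additive. -/
theorem isCountablyAdditive_of_setwise_limit {m : ℕ → Measure X}
    [∀ n, IsProbabilityMeasure (m n)] {φ : BA X} (hφ : φ ∈ Sba X)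
    (hlim : ∀ E, MeasurableSet E → Tendsto (fun n => (m n).real E) atTop (𝓝 (φ E))) :
    φ.IsCountablyAdditive := by
  intro F hF hd
  let T : ℕ → Set X := fun n => ⋃ i, F (n + i)
  have hT : ∀ n, MeasurableSet (T n) := fun n => MeasurableSet.iUnion fun i => hF _
  have hTsucc : ∀ n, T n = F n ∪ T (n + 1) := fun n => by
    ext x
    simp only [T, Set.mem_iUnion, Set.mem_union]
    constructor
    · rintro ⟨i, hi⟩
      rcases i with _ | i
      · exact Or.inl hi
      · exact Or.inr ⟨i, by rwa [show n + 1 + i = n + (i + 1) by ring]⟩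
    · rintro (h | ⟨i, hi⟩)
      · exact ⟨0, h⟩
      · exact ⟨i + 1, by rwa [show n + (i + 1) = n + 1 + i by ring]⟩
  have hTd : ∀ n, Disjoint (F n) (T (n + 1)) := fun n =>
    Set.disjoint_iUnion_right.2 fun i => hd (by omega)
  have hanti : Antitone T := antitone_nat_of_succ_le fun n => by
    rw [hTsucc n]; exact Set.subset_union_right
  have hempty : ⋂ n, T n = ∅ := by
    refine Set.eq_empty_of_forall_notMem fun x hx => ?_
    rw [Set.mem_iInter] at hx
    obtain ⟨i, hi⟩ := Set.mem_iUnion.1 (hx 0)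
    obtain ⟨l, hl⟩ := Set.mem_iUnion.1 (hx (i + 1))
    exact Set.disjoint_left.1 (hd (i := 0 + i) (j := i + 1 + l) (by omega)) hi hl
  have hsum : ∀ n, φ (T 0) = ∑ i ∈ Finset.range n, φ (F i) + φ (T n) := fun n => by
    induction n with
    | zero => simp
    | succ n ih =>
      rw [ih, Finset.sum_range_succ, hTsucc n, φ.apply_union (hF n) (hT _) (hTd n)]
      ring
  have h0 : T 0 = ⋃ i, F i := by simp [T]
  rw [hasSum_iff_tendsto_nat_of_nonneg fun i => hφ.1 _ (hF i), ← h0]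
  have := (tendsto_apply_zero_of_setwise_limit hφ hlim hT hanti hempty).const_sub (φ (T 0))
  rw [sub_zero] at this
  refine this.congr fun n => ?_
  rw [hsum n]
  ring

/-! ### The dual of `L¹` of a probability measure -/

/-- A continuous linear functional on `L¹` of a probability measure is integration against a
bounded measurable function, which the Riesz representation of its restriction to `L²`
provides. -/
theorem exists_bddMeas_repr {ν : Measure X} [IsProbabilityMeasure ν]
    (F : Lp ℝ 1 ν →L[ℝ] ℝ) : ∃ w : X → ℝ, BddMeas w ∧ ∀ h : Lp ℝ 1 ν, F h = ∫ x, w x * h x ∂ν := by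
  have h12 : (1 : ENNReal) ≤ 2 := one_le_two
  let ι : Lp ℝ 2 ν →L[ℝ] Lp ℝ 1 ν := LinearMap.mkContinuous
    { toFun := fun f => ⟨f.1, Lp.antitone h12 f.2⟩
      map_add' := fun _ _ => rfl
      map_smul' := fun _ _ => rfl } 1 fun f => by
    rw [one_mul, Lp.norm_def, Lp.norm_def]
    refine ENNReal.toReal_mono (Lp.eLpNorm_ne_top f) ?_
    exact eLpNorm_le_eLpNorm_of_exponent_le h12 (Lp.aestronglyMeasurable f)
  let v : Lp ℝ 2 ν := (InnerProductSpace.toDual ℝ (Lp ℝ 2 ν)).symm (F.comp ι)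
  have hv : ∀ E (hE : MeasurableSet E),
      F (indicatorConstLp 1 hE (measure_ne_top ν E) 1) = ∫ x in E, v x ∂ν := fun E hE => by
    have h1 : inner ℝ v (indicatorConstLp 2 hE (measure_ne_top ν E) (1 : ℝ))
        = F (ι (indicatorConstLp 2 hE (measure_ne_top ν E) 1)) :=
      InnerProductSpace.toDual_symm_apply
    rw [real_inner_comm, L2.inner_indicatorConstLp_one] at h1
    exact h1.symm
  have hvi : Integrable v ν := (Lp.memLp v).integrable h12
  set C := ‖F‖ with hC
  have hFE : ∀ E (hE : MeasurableSet E),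
      |F (indicatorConstLp 1 hE (measure_ne_top ν E) 1)| ≤ C * ν.real E := fun E hE => by
    have := F.le_opNorm (indicatorConstLp 1 hE (measure_ne_top ν E) 1)
    rwa [norm_indicatorConstLp one_ne_zero ENNReal.one_ne_top, norm_one, ENNReal.toReal_one,
      div_one, Real.rpow_one, one_mul] at this
  have hup : ∀ᵐ x ∂ν, v x ≤ C := by
    refine ae_le_of_forall_setIntegral_le hvi (integrable_const C) fun E hE _ => ?_
    rw [← hv E hE, setIntegral_const, smul_eq_mul, mul_comm]
    exact (le_abs_self _).trans (hFE E hE)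
  have hlow : ∀ᵐ x ∂ν, -C ≤ v x := by
    refine ae_le_of_forall_setIntegral_le (integrable_const _) hvi fun E hE _ => ?_
    rw [← hv E hE, setIntegral_const, smul_eq_mul, mul_comm, neg_mul]
    exact (abs_le.1 (hFE E hE)).1
  let v' : X → ℝ := (Lp.aestronglyMeasurable v).mk v
  have hv' : Measurable v' := (Lp.aestronglyMeasurable v).stronglyMeasurable_mk.measurable
  let w : X → ℝ := fun x => max (-C) (min C (v' x))
  have hC0 : 0 ≤ C := norm_nonneg F
  have hwC : ∀ x, |w x| ≤ C := fun x =>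
    abs_le.2 ⟨le_max_left _ _, max_le (by linarith) (min_le_left _ _)⟩
  have hw : BddMeas w := ⟨measurable_const.max (measurable_const.min hv'), C, hwC⟩
  have hwv : w =ᵐ[ν] v := by
    filter_upwards [hup, hlow, (Lp.aestronglyMeasurable v).ae_eq_mk] with x h1 h2 h3
    simp only [w, v']
    rw [← h3, min_eq_right h1, max_eq_right h2]
  have hint : ∀ h : Lp ℝ 1 ν, Integrable (fun x => w x * h x) ν := fun h =>
    (L1.integrable_coeFn h).bdd_mul hw.1.aestronglyMeasurable (ae_of_all _ hwC)
  refine ⟨w, hw, fun h => ?_⟩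
  refine Lp.induction ENNReal.one_ne_top (motive := fun h : Lp ℝ 1 ν => F h = ∫ x, w x * h x ∂ν)
    (fun c E hE hνE => ?_) (fun f g hf hg _ h1 h2 => ?_) ?_ h
  · have h1 : (Lp.simpleFunc.indicatorConst 1 hE hνE.ne c : Lp ℝ 1 ν)
        = c • indicatorConstLp 1 hE (measure_ne_top ν E) (1 : ℝ) := by
      rw [Lp.simpleFunc.coe_indicatorConst, indicatorConstLp, indicatorConstLp,
        ← MemLp.toLp_const_smul]
      congr 1
      ext x
      by_cases hx : x ∈ E <;> simp [hx]
    have h2 : ∫ x, w x * (indicatorConstLp 1 hE (measure_ne_top ν E) (1 : ℝ) : Lp ℝ 1 ν) x ∂ν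
        = ∫ x in E, v x ∂ν := by
      rw [← MeasureTheory.integral_indicator hE]
      refine integral_congr_ae ?_
      filter_upwards [hwv, indicatorConstLp_coeFn (p := 1) (hs := hE)
        (hμs := measure_ne_top ν E) (c := (1 : ℝ))] with x h3 h4
      rw [h4, h3]
      by_cases hx : x ∈ E <;> simp [hx]
    rw [h1, map_smul, hv, ← h2, smul_eq_mul, ← MeasureTheory.integral_const_mul]
    refine integral_congr_ae ?_
    filter_upwards [Lp.coeFn_smul c (indicatorConstLp 1 hE (measure_ne_top ν E) (1 : ℝ))] with x hx
    rw [hx, Pi.smul_apply, smul_eq_mul]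
    ring
  · rw [map_add, h1, h2, ← MeasureTheory.integral_add (hint _) (hint _)]
    refine integral_congr_ae ?_
    filter_upwards [Lp.coeFn_add (hf.toLp f) (hg.toLp g)] with x hx
    rw [hx, Pi.add_apply]
    ring
  · refine isClosed_eq F.continuous (LipschitzWith.continuous (K := ⟨C, hC0⟩)
      (LipschitzWith.of_dist_le_mul fun f g => ?_))
    rw [Real.dist_eq, dist_eq_norm, ← MeasureTheory.integral_sub (hint f) (hint g),
      L1.norm_eq_integral_norm]
    change _ ≤ C * _
    rw [← MeasureTheory.integral_const_mul, ← Real.norm_eq_abs]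
    refine norm_integral_le_of_norm_le ((L1.integrable_coeFn (f - g)).norm.const_mul C) ?_
    filter_upwards [Lp.coeFn_sub f g] with x hx
    rw [hx, Pi.sub_apply, ← mul_sub, norm_mul]
    exact mul_le_mul_of_nonneg_right (hwC x) (norm_nonneg _)

open Classical in
/-- The finitely additive measure `E ↦ ∫_E h dν` with density `h ∈ L¹(ν)`, as a bounded linear map
in `h`. -/
def BA.ofL1 (ν : Measure X) : Lp ℝ 1 ν →L[ℝ] BA X :=
  LinearMap.mkContinuous
    { toFun := fun h => (⟨fun E => if MeasurableSet E then ∫ x in E, h x ∂ν else 0, by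
        refine ⟨by simp, fun E F hE hF hd => ?_, ⟨‖h‖, fun E hE => ?_⟩, fun E hE => if_neg hE⟩
        · simp only [hE, hF, hE.union hF, if_true]
          exact setIntegral_union hd hF (L1.integrable_coeFn h).integrableOn
            (L1.integrable_coeFn h).integrableOn
        · simp only [hE, if_true, L1.norm_eq_integral_norm]
          exact (norm_integral_le_integral_norm _).trans (setIntegral_le_integral
            (L1.integrable_coeFn h).norm (ae_of_all _ fun x => _root_.norm_nonneg _))⟩ : BA X)
      map_add' := fun f g => BA.ext fun E hE => by
        change (if MeasurableSet E then ∫ x in E, (f + g) x ∂ν else 0)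
          = (if MeasurableSet E then ∫ x in E, f x ∂ν else 0)
            + (if MeasurableSet E then ∫ x in E, g x ∂ν else 0)
        simp only [hE, if_true]
        rw [← MeasureTheory.integral_add (L1.integrable_coeFn f).integrableOn
          (L1.integrable_coeFn g).integrableOn]
        exact integral_congr_ae (ae_restrict_of_ae (Lp.coeFn_add f g))
      map_smul' := fun c f => BA.ext fun E hE => by
        change (if MeasurableSet E then ∫ x in E, (c • f) x ∂ν else 0)
          = c * (if MeasurableSet E then ∫ x in E, f x ∂ν else 0)
        simp only [hE, if_true]
        rw [← MeasureTheory.integral_const_mul]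
        exact integral_congr_ae (ae_restrict_of_ae (Lp.coeFn_smul c f)) } 2
    fun h => BA.norm_le_of_forall_abs_apply_le _ fun E hE => by
      change |if MeasurableSet E then ∫ x in E, h x ∂ν else 0| ≤ _
      rw [if_pos hE, L1.norm_eq_integral_norm]
      exact (norm_integral_le_integral_norm _).trans (setIntegral_le_integral
        (L1.integrable_coeFn h).norm (ae_of_all _ fun x => _root_.norm_nonneg _))

theorem BA.ofL1_apply (ν : Measure X) (h : Lp ℝ 1 ν) {E : Set X} (hE : MeasurableSet E) :
    BA.ofL1 ν h E = ∫ x in E, h x ∂ν := if_pos hE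

/-- Mazur's theorem for measures: if the integrals of bounded measurable functions do not separate
a finite measure `m` from a sequence of finite measures `p k`, then `m` is in the
closed convex hull of the sequence for the total variation norm. The sequence and `m` are dominated
by one probability measure `ν`, so this takes place in `L¹(ν)`. -/
theorem ofMeasure_mem_closure_convexHull (p : ℕ → Measure X) [∀ k, IsFiniteMeasure (p k)]
    (m : Measure X) [IsProbabilityMeasure m]
    (hsep : ∀ (w : X → ℝ) (u : ℝ), BddMeas w → (∀ k, ∫ x, w x ∂p k < u) → ∫ x, w x ∂m ≤ u) :
    BA.ofMeasure m ∈ closure (convexHull ℝ (Set.range fun k => BA.ofMeasure (p k))) := by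
  let ν : Measure X := (Measure.sum p + m).toFinite
  have hne : NeZero (Measure.sum p + m) := ⟨fun h => by
    have := congrArg (fun m : Measure X => m Set.univ) h
    simp at this⟩
  have hν : IsProbabilityMeasure ν := inferInstance
  have hpν : ∀ k, p k ≪ ν := fun k =>
    ((Measure.le_sum p k).trans (Measure.le_add_right le_rfl)).absolutelyContinuous.trans
      (absolutelyContinuous_toFinite _)
  have hmν : m ≪ ν :=
    (Measure.le_add_left le_rfl : m ≤ Measure.sum p + m).absolutelyContinuous.trans
      (absolutelyContinuous_toFinite _)
  let dens : (q : Measure X) → [IsFiniteMeasure q] → Lp ℝ 1 ν := fun q _ =>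
    (Measure.integrable_toReal_rnDeriv (μ := q) (ν := ν)).toL1 _
  let Φ : Lp ℝ 1 ν →L[ℝ] BA X := BA.ofL1 ν
  have hΦ : ∀ (q : Measure X) [IsFiniteMeasure q], q ≪ ν → Φ (dens q) = BA.ofMeasure q := by
    intro q _ hq
    refine BA.ext fun E hE => ?_
    rw [BA.ofL1_apply _ _ hE, BA.ofMeasure_apply q hE, ← Measure.setIntegral_toReal_rnDeriv hq E]
    exact integral_congr_ae (ae_restrict_of_ae (Integrable.coeFn_toL1 _))
  have hdens : ∀ (q : Measure X) [IsFiniteMeasure q], q ≪ ν → ∀ w : X → ℝ,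
      ∫ x, w x * dens q x ∂ν = ∫ x, w x ∂q := by
    intro q _ hq w
    rw [← integral_rnDeriv_smul hq]
    refine integral_congr_ae ?_
    filter_upwards [Integrable.coeFn_toL1
      (Measure.integrable_toReal_rnDeriv (μ := q) (ν := ν))] with x hx
    rw [hx, smul_eq_mul, mul_comm]
  have key : dens m ∈ closure (convexHull ℝ (Set.range fun k => dens (p k))) := by
    by_contra hcon
    obtain ⟨F, u, hF, hu⟩ := geometric_hahn_banach_closed_point
      (convex_convexHull ℝ (Set.range fun k => dens (p k))).closure isClosed_closure hcon
    obtain ⟨w, hw, hFw⟩ := exists_bddMeas_repr F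
    refine absurd hu (not_lt.2 ?_)
    rw [hFw, hdens m hmν]
    refine hsep w u hw fun k => ?_
    rw [← hdens (p k) (hpν k), ← hFw]
    exact hF _ (subset_closure (subset_convexHull ℝ _ ⟨k, rfl⟩))
  have h1 := image_closure_subset_closure_image Φ.continuous ⟨_, key, rfl⟩
  rw [hΦ m hmν] at h1
  have h2 := Φ.toLinearMap.image_convexHull (Set.range fun k => dens (p k))
  rw [ContinuousLinearMap.coe_coe] at h2
  rw [h2, ← Set.range_comp] at h1
  convert h1 using 5 with k
  exact (hΦ (p k) (hpν k)).symm

end GenMarkov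

end

noncomputable section

namespace GenMarkov

variable {X : Type*} [MeasurableSpace X] {κ : Kernel X X} [IsMarkovKernel κ] {μ : BA X}

/-! ### Uniform convergence of the Cesàro means -/

theorem BA.isCountablyAdditive_ofMeasure (m : Measure X) [IsFiniteMeasure m] :
    (BA.ofMeasure m).IsCountablyAdditive := by
  intro E hE hd
  rw [BA.ofMeasure_apply m (MeasurableSet.iUnion hE), measureReal_def, measure_iUnion hd hE,
    ENNReal.tsum_toReal_eq fun i => measure_ne_top m _]
  simp only [BA.ofMeasure_apply m (hE _)]
  refine (ENNReal.summable_toReal ?_).hasSum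
  rw [← measure_iUnion hd hE]
  exact measure_ne_top m _

theorem isCountablyAdditive_cesaro_dirac (κ : Kernel X X) [IsMarkovKernel κ] (n : ℕ) (x : X) :
    (cesaro κ n (BA.ofMeasure (Measure.dirac x))).IsCountablyAdditive := by
  intro E hE hd
  simp only [cesaro, BA.smul_apply, BA.sum_apply, markovOp_pow_dirac]
  exact (hasSum_sum fun k _ => BA.isCountablyAdditive_ofMeasure _ E hE hd).mul_left _

theorem cesaro_dirac_apply (κ : Kernel X X) [IsMarkovKernel κ] (n : ℕ) (x : X) {E : Set X}
    (hE : MeasurableSet E) : cesaro κ n (BA.ofMeasure (Measure.dirac x)) E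
      = 1 / (n : ℝ) * ∑ k ∈ Finset.Icc 1 n, ((κ ^ k) x).real E := by
  simp only [cesaro, BA.smul_apply, BA.sum_apply, markovOp_pow_dirac, BA.ofMeasure_apply _ hE]

theorem bddMeas_cesaro_dirac (κ : Kernel X X) [IsMarkovKernel κ] (n : ℕ) {E : Set X}
    (hE : MeasurableSet E) :
    BddMeas fun x => cesaro κ n (BA.ofMeasure (Measure.dirac x)) E := by
  simp only [cesaro_dirac_apply κ n _ hE]
  exact (BddMeas.sum fun k _ => bddMeas_kernel_real (κ ^ k) hE).const_mul _

theorem cesaro_apply_eq_integral (κ : Kernel X X) [IsMarkovKernel κ] (n : ℕ) (φ : BA X)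
    {E : Set X} (hE : MeasurableSet E) :
    cesaro κ n φ E = φ.integral fun x => cesaro κ n (BA.ofMeasure (Measure.dirac x)) E := by
  have hb : ∀ k ∈ Finset.Icc 1 n, BddMeas fun x => ((κ ^ k) x).real E := fun k _ =>
    bddMeas_kernel_real (κ ^ k) hE
  simp only [cesaro_dirac_apply κ n _ hE]
  rw [φ.integral_const_mul _ (.sum hb), φ.integral_sum hb]
  simp only [cesaro, BA.smul_apply, BA.sum_apply, markovOp_pow_apply κ _ _ hE]

theorem cesaro_dirac_integral (κ : Kernel X X) [IsMarkovKernel κ] (n : ℕ) (x : X) {f : X → ℝ}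
    (hf : BddMeas f) : (cesaro κ n (BA.ofMeasure (Measure.dirac x))).integral f
      = 1 / (n : ℝ) * ∑ k ∈ Finset.Icc 1 n, ∫ y, f y ∂(κ ^ k) x := by
  obtain ⟨hm, C, hC⟩ := hf
  rw [cesaro, BA.smul_integral _ _ hm hC, BA.sum_integral _ _ ⟨hm, C, hC⟩]
  simp only [markovOp_pow_dirac, BA.ofMeasure_integral _ ⟨hm, C, hC⟩]

theorem mem_Sba_of_unique (hμ : Deltaba κ = {μ}) : μ ∈ Sba X :=
  (hμ.symm ▸ Set.mem_singleton μ : μ ∈ Deltaba κ).1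

theorem markovOp_eq_of_unique (hμ : Deltaba κ = {μ}) : markovOp κ μ = μ :=
  (hμ.symm ▸ Set.mem_singleton μ : μ ∈ Deltaba κ).2

theorem nonempty_of_mem_Sba (hμ : μ ∈ Sba X) : Nonempty X := by
  by_contra h
  rw [not_nonempty_iff] at h
  have h1 := (mem_Sba_iff.1 hμ).2
  rw [Set.univ_eq_empty_iff.2 h, μ.apply_empty] at h1
  exact zero_ne_one h1

/-- The unique invariant mean is a measure: by Nikodym's theorem, as the setwise limit of
the Cesàro means of a point mass. -/
theorem exists_measure_of_unique (hμ : Deltaba κ = {μ}) :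
    ∃ (m : Measure X) (_ : IsProbabilityMeasure m), μ = BA.ofMeasure m := by
  have hmem := mem_Sba_of_unique hμ
  obtain ⟨x⟩ := nonempty_of_mem_Sba hmem
  choose p hp hpc using fun n : ℕ => BA.exists_measure_of_isCountablyAdditive
    (cesaro_mem_Sba κ (Nat.succ_pos n) (BA.ofMeasure_mem_Sba (Measure.dirac x)))
    (isCountablyAdditive_cesaro_dirac κ (n + 1) x)
  refine BA.exists_measure_of_isCountablyAdditive hmem
    (isCountablyAdditive_of_setwise_limit (m := p) hmem fun E hE => ?_)
  rw [Metric.tendsto_atTop]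
  intro ε hε
  obtain ⟨N, hN⟩ := exists_forall_abs_cesaro_apply_sub_lt hμ hE hε
  refine ⟨N, fun n hn => ?_⟩
  rw [Real.dist_eq, ← BA.ofMeasure_apply (p n) hE, ← hpc n]
  exact hN _ (by omega) _ (BA.ofMeasure_mem_Sba _)

/-- From each starting point the Cesàro means converge in total variation, by the mean ergodic
theorem. -/
theorem tendsto_cesaro_dirac (hμ : Deltaba κ = {μ}) (x : X) :
    Tendsto (fun n => cesaro κ n (BA.ofMeasure (Measure.dirac x))) atTop (𝓝 μ) := by
  simp only [cesaro_eq_meanOp]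
  refine tendsto_meanOp_of_mem_closure_convexHull (norm_markovOp_le κ)
    (markovOp_eq_of_unique hμ) ?_
  simp only [markovOp_pow_dirac]
  have hmem := mem_Sba_of_unique hμ
  obtain ⟨m, hm, hmμ⟩ := exists_measure_of_unique hμ
  have hlim : ∀ w, BddMeas w → Tendsto (fun n : ℕ =>
      (cesaro κ (n + 1) (BA.ofMeasure (Measure.dirac x))).integral w) atTop
      (𝓝 (μ.integral w)) := fun w hw =>
    tendsto_integral_of_setwise (fun n => cesaro_mem_Sba κ (Nat.succ_pos n)
      (BA.ofMeasure_mem_Sba _)) hmem (fun E hE => by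
        rw [Metric.tendsto_atTop]
        intro ε hε
        obtain ⟨N, hN⟩ := exists_forall_abs_cesaro_apply_sub_lt hμ hE hε
        exact ⟨N, fun n hn => hN _ (by omega) _ (BA.ofMeasure_mem_Sba _)⟩) hw
  rw [hmμ]
  refine ofMeasure_mem_closure_convexHull _ m fun w u hw hu => ?_
  have h1 := hlim w hw
  rw [hmμ, BA.ofMeasure_integral m hw] at h1
  refine le_of_tendsto' h1 fun n => ?_
  rw [cesaro_dirac_integral κ _ x hw, one_div, inv_mul_le_iff₀ (by positivity)]
  refine (Finset.sum_le_card_nsmul _ _ u fun k _ => (hu k).le).trans_eq ?_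
  simp

/-- A twofold Cesàro mean evaluated on an arbitrary sequence of sets. The inner means of the
indicator functions converge to constants pointwise, and the outer means charge the exceptional
sets uniformly little. -/
theorem exists_forall_abs_cesaro_cesaro_apply_sub_le (hμ : Deltaba κ = {μ}) {E : ℕ → Set X}
    (hE : ∀ n, MeasurableSet (E n)) {ε : ℝ} (hε : 0 < ε) :
    ∃ N : ℕ, ∀ n, N ≤ n → ∀ η ∈ Sba X, |cesaro κ n (cesaro κ n η) (E n) - μ (E n)| ≤ ε := by
  have hmem := mem_Sba_of_unique hμ
  let g : ℕ → X → ℝ := fun n x => cesaro κ n (BA.ofMeasure (Measure.dirac x)) (E n) - μ (E n)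
  have hg : ∀ n, BddMeas (g n) := fun n => (bddMeas_cesaro_dirac κ n (hE n)).sub (.const _)
  let F : ℕ → Set X := fun n => {x | ε / 2 < |g n x|}
  have hF : ∀ n, MeasurableSet (F n) := fun n => by
    have h1 : Measurable fun x => |g n x| := by
      simpa only [Real.norm_eq_abs] using (hg n).1.norm
    exact measurableSet_lt measurable_const h1
  let G : ℕ → Set X := fun k => ⋃ i, F (k + i)
  have hG : ∀ k, MeasurableSet (G k) := fun k => MeasurableSet.iUnion fun i => hF _
  have hanti : Antitone G := antitone_nat_of_succ_le fun k x hx => by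
    obtain ⟨i, hi⟩ := Set.mem_iUnion.1 hx
    exact Set.mem_iUnion.2 ⟨i + 1, by rwa [show k + (i + 1) = k + 1 + i by ring]⟩
  have hempty : ⋂ k, G k = ∅ := by
    refine Set.eq_empty_of_forall_notMem fun x hx => ?_
    obtain ⟨N, hN⟩ := Metric.tendsto_atTop.1 (tendsto_cesaro_dirac hμ x) (ε / 2) (half_pos hε)
    obtain ⟨i, hi⟩ := Set.mem_iUnion.1 (Set.mem_iInter.1 hx N)
    have h1 := hN (N + i) (by omega)
    rw [dist_eq_norm] at h1
    have h2 := (BA.abs_apply_le_norm _ (hE (N + i))).trans_lt h1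
    exact lt_asymm hi h2
  have hμG : Tendsto (fun k => μ (G k)) atTop (𝓝 0) := by
    obtain ⟨m, hm, hmμ⟩ := exists_measure_of_unique hμ
    refine tendsto_apply_zero_of_setwise_limit (m := fun _ => m) hmem (fun E hE => ?_) hG hanti
      hempty
    rw [hmμ, BA.ofMeasure_apply m hE]
    exact tendsto_const_nhds
  obtain ⟨k, hk⟩ := ((tendsto_order.1 hμG).2 (ε / 4) (by positivity)).exists
  obtain ⟨N, hN⟩ := exists_forall_abs_cesaro_apply_sub_lt hμ (hG k) (show 0 < ε / 4 by positivity)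
  refine ⟨max N (max k 1), fun n hn η hη => ?_⟩
  have hn1 : 1 ≤ n := by omega
  have hCη := cesaro_mem_Sba κ hn1 hη
  have hsmall : cesaro κ n η (G k) ≤ ε / 2 := by
    have := (abs_lt.1 (hN n (by omega) η hη)).2
    linarith
  have hkey : cesaro κ n (cesaro κ n η) (E n) - μ (E n) = (cesaro κ n η).integral (g n) := by
    rw [BA.integral_sub _ (bddMeas_cesaro_dirac κ n (hE n)) (.const _), BA.integral_const,
      (mem_Sba_iff.1 hCη).2, mul_one, ← cesaro_apply_eq_integral κ n _ (hE n)]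
  have h01 : ∀ φ ∈ Sba X, φ (E n) ∈ Set.Icc (0 : ℝ) 1 := fun φ hφ =>
    ⟨hφ.1 _ (hE n), (le_abs_self _).trans ((BA.abs_apply_le_norm _ (hE n)).trans_eq hφ.2)⟩
  have hle : ∀ x, |g n x| ≤ ε / 2 + (G k).indicator (fun _ => 1) x := fun x => by
    by_cases hx : x ∈ F n
    · have hxG : x ∈ G k := Set.mem_iUnion.2 ⟨n - k, by rwa [show k + (n - k) = n by omega]⟩
      have h1 := h01 _ (cesaro_mem_Sba κ hn1 (BA.ofMeasure_mem_Sba (Measure.dirac x)))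
      have h2 := h01 μ hmem
      rw [Set.indicator_of_mem hxG, abs_le]
      constructor <;> simp only [g] <;> linarith [h1.1, h1.2, h2.1, h2.2]
    · have h1 : |g n x| ≤ ε / 2 := not_lt.1 hx
      have h2 : 0 ≤ (G k).indicator (fun _ => (1 : ℝ)) x :=
        Set.indicator_nonneg (fun _ _ => zero_le_one) x
      linarith
  have hb : BddMeas fun x => ε / 2 + (G k).indicator (fun _ => (1 : ℝ)) x :=
    (BddMeas.const _).add (.indicator (hG k) 1)
  have hint : (cesaro κ n η).integral (fun x => ε / 2 + (G k).indicator (fun _ => (1 : ℝ)) x)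
      ≤ ε := by
    rw [BA.integral_add' _ (.const _) (.indicator (hG k) 1), BA.integral_const,
      BA.integral_indicator _ 1 (hG k), (mem_Sba_iff.1 hCη).2]
    linarith
  rw [hkey, abs_le]
  constructor
  · have h1 := BA.integral_mono _ hCη.1 (hb.const_mul (-1)) (hg n) fun x => by
      linarith [neg_le_of_abs_le (hle x)]
    rw [BA.integral_const_mul _ _ hb] at h1
    linarith
  · exact (BA.integral_mono _ hCη.1 (hg n) hb fun x => le_of_abs_le (hle x)).trans hint

theorem exists_forall_norm_cesaro_cesaro_sub_le (hμ : Deltaba κ = {μ}) {ε : ℝ} (hε : 0 < ε) :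
    ∃ n : ℕ, 1 ≤ n ∧ ∀ η ∈ Sba X, ‖cesaro κ n (cesaro κ n η) - μ‖ ≤ ε := by
  by_contra! hcon
  have hbad : ∀ n : ℕ, ∃ η ∈ Sba X, ∃ E, MeasurableSet E ∧
      ε / 2 < |cesaro κ (n + 1) (cesaro κ (n + 1) η) E - μ E| := fun n => by
    obtain ⟨η, hη, hlt⟩ := hcon (n + 1) (by omega)
    refine ⟨η, hη, ?_⟩
    by_contra! h
    have := BA.norm_le_of_forall_abs_apply_le
      (cesaro κ (n + 1) (cesaro κ (n + 1) η) - μ) (C := ε / 2) h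
    linarith
  choose η hη E hE hlt using hbad
  obtain ⟨N, hN⟩ := exists_forall_abs_cesaro_cesaro_apply_sub_le hμ (E := fun n => E (n - 1))
    (fun n => hE _) (half_pos hε)
  exact absurd (hN (N + 1) (by omega) (η N) (hη N)) (not_le.2 (hlt N))

/-- If there is exactly one invariant mean, the Cesàro means converge to it in total variation,
uniformly over all finitely additive initial measures. -/
theorem exists_forall_norm_cesaro_sub_lt (hμ : Deltaba κ = {μ}) {ε : ℝ} (hε : 0 < ε) :
    ∃ N : ℕ, ∀ n, N ≤ n → ∀ η ∈ Sba X, ‖cesaro κ n η - μ‖ < ε := by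
  obtain ⟨n, hn, hn'⟩ := exists_forall_norm_cesaro_cesaro_sub_le hμ (half_pos hε)
  have hA := norm_markovOp_le κ
  have hn0 : (0 : ℝ) < n := by exact_mod_cast hn
  obtain ⟨M, hM⟩ := exists_nat_gt (8 * n / ε)
  refine ⟨max M 1, fun N hN η hη => ?_⟩
  have hN0 : (0 : ℝ) < N := by exact_mod_cast (by omega : 0 < N)
  have hlt : 2 * (n : ℝ) / N < ε / 4 := by
    have : (M : ℝ) ≤ N := by exact_mod_cast (by omega : M ≤ N)
    rw [div_lt_iff₀ hN0]
    rw [div_lt_iff₀ hε] at hM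
    nlinarith
  have h1 := hn' _ (cesaro_mem_Sba κ (show 1 ≤ N by omega) hη)
  simp only [cesaro_eq_meanOp] at h1 ⊢
  set C := meanOp (markovOp κ) with hC
  have hc : ∀ v, C n (C N v) = C N (C n v) := fun v =>
    LinearMap.congr_fun (commute_meanOp (markovOp κ) n N) v
  rw [hc, hc] at h1
  have hη1 : ‖η‖ = 1 := hη.2
  have h2 := norm_meanOp_meanOp_sub_le hA N hn (C n η)
  have h3 := norm_meanOp_meanOp_sub_le hA N hn η
  have h4 : ‖C n η‖ ≤ 1 := (norm_meanOp_le hA n η).trans_eq hη1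
  rw [hη1, mul_one] at h3
  have h5 : 2 * (n : ℝ) / N * ‖C n η‖ ≤ 2 * n / N * 1 := by gcongr
  calc ‖C N η - μ‖ = ‖(C N (C n (C n η)) - μ) - (C N (C n (C n η)) - C N (C n η))
          - (C N (C n η) - C N η)‖ := by congr 1; abel
    _ ≤ ‖C N (C n (C n η)) - μ‖ + ‖C N (C n (C n η)) - C N (C n η)‖
          + ‖C N (C n η) - C N η‖ :=
        (norm_sub_le _ _).trans (add_le_add (norm_sub_le _ _) le_rfl)
    _ < ε := by linarith

end GenMarkov

end

noncomputable section

namespace GenMarkov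

variable {X : Type*} [MeasurableSpace X] {κ : Kernel X X} [IsMarkovKernel κ] {μ : BA X}

/-! ### Cycles and invariant measures of the powers -/

/-- Without cycles, the powers of the kernel have no further invariant means: the orbit of an
invariant mean of a power, over its minimal period, would be a cycle. -/
theorem Deltaba_pow_eq (hμ : Deltaba κ = {μ}) (hs : IsSimple κ μ) {d : ℕ} (hd : 1 ≤ d) :
    Deltaba (κ ^ d) = {μ} := by
  refine Set.eq_singleton_iff_unique_mem.2 ⟨⟨mem_Sba_of_unique hμ, ?_⟩, ?_⟩
  · rw [markovOp_pow]; exact pow_apply_eq_self (markovOp_eq_of_unique hμ) d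
  rintro ν ⟨hν, hνd⟩
  rw [markovOp_pow, Module.End.pow_apply] at hνd
  have hper : Function.IsPeriodicPt (markovOp κ) d ν := hνd
  set p := Function.minimalPeriod (markovOp κ) ν with hp
  have hp0 : 0 < p := hper.minimalPeriod_pos hd
  have hp0' : (p : ℝ) ≠ 0 := by exact_mod_cast hp0.ne'
  rcases (Nat.succ_le_of_lt hp0).eq_or_lt with h1 | h2
  · have hfix : markovOp κ ν = ν := Function.minimalPeriod_eq_one_iff_isFixedPt.1 h1.symm
    have : ν ∈ Deltaba κ := ⟨hν, hfix⟩
    rwa [hμ] at this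
  exfalso
  let c : Fin p → BA X := fun i => (markovOp κ)^[i] ν
  have hc : ∀ i, c i ∈ Sba X := fun i => by
    simpa only [c, Module.End.pow_apply] using markovOp_pow_mem_Sba κ hν i
  have hmap : ∀ i, markovOp κ (c i) = c (finRotate p i) := fun i => by
    have : NeZero p := ⟨hp0.ne'⟩
    simp only [c]
    rw [← Function.iterate_succ_apply' (markovOp κ), finRotate_apply, Fin.val_add,
      Fin.val_one', Nat.add_mod_mod]
    exact Function.iterate_mod_minimalPeriod_eq.symm
  have hcyc : IsCycle κ c :=
    { two_le := h2
      injective := fun i j hij => Fin.ext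
        (Function.iterate_injOn_Iio_minimalPeriod (Set.mem_Iio.2 i.2) (Set.mem_Iio.2 j.2) hij)
      mem_Sba := hc
      map_eq := hmap }
  refine hs ⟨p, c, hcyc, ?_⟩
  have hmean : (1 / (p : ℝ)) • ∑ i, c i ∈ Deltaba κ := by
    refine ⟨?_, ?_⟩
    · rw [Finset.smul_sum]
      exact Sba_convex.sum_mem (fun _ _ => by positivity) (by simp [hp0']) fun i _ => hc i
    · rw [map_smul, map_sum, Finset.sum_congr rfl fun i _ => hmap i]
      rw [Equiv.sum_comp (finRotate p) c]
  rw [hμ] at hmean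
  exact hmean.symm

end GenMarkov

end

noncomputable section

/-! ### Approximate eigenvectors of power bounded operators -/

section ApproximateEigenvector

variable {E : Type*} [NormedAddCommGroup E] [NormedSpace ℂ E] [CompleteSpace E]

/-- A spectral value of maximal modulus is an approximate eigenvalue. -/
theorem exists_norm_map_sub_smul_lt [Nontrivial E] (S : E →L[ℂ] E) {z : ℂ}
    (hz : z ∈ spectrum ℂ S) (hmax : ∀ w ∈ spectrum ℂ S, ‖w‖ ≤ ‖z‖) (hz0 : z ≠ 0) {ε : ℝ}
    (hε : 0 < ε) : ∃ f : E, ‖S f - z • f‖ < ε * ‖f‖ := by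
  by_contra! hcon
  -- a nearby point of the resolvent set, where the resolvent is bounded by `2 / ε`
  have hnz : 0 < ‖z‖ := norm_pos_iff.2 hz0
  set t : ℝ := min (ε / 4) 1 / ‖z‖ with ht
  have ht0 : 0 < t := by positivity
  set w : ℂ := z + (t : ℂ) * z with hw
  have hwz : ‖w - z‖ ≤ ε / 4 := by
    rw [hw, add_sub_cancel_left, norm_mul, Complex.norm_real, Real.norm_eq_abs, abs_of_pos ht0, ht,
      div_mul_cancel₀ _ hnz.ne']
    exact min_le_left _ _
  have hwn : ‖z‖ < ‖w‖ := by
    have : w = ((1 + t : ℝ) : ℂ) * z := by rw [hw]; push_cast; ring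
    rw [this, norm_mul, Complex.norm_real, Real.norm_eq_abs, abs_of_pos (by linarith)]
    nlinarith
  have hwr : w ∉ spectrum ℂ S := fun h => absurd (hmax w h) (not_le.2 hwn)
  rw [spectrum.notMem_iff] at hwr
  obtain ⟨u, hu⟩ := hwr
  have huapp : ∀ f, (u : E →L[ℂ] E) f = w • f - S f := fun f => by
    rw [hu]; simp [Algebra.algebraMap_eq_smul_one]
  have hlow : ∀ f, ε / 2 * ‖f‖ ≤ ‖(u : E →L[ℂ] E) f‖ := fun f => by
    have h1 := hcon f
    have h2 : S f - z • f = (w - z) • f - (u : E →L[ℂ] E) f := by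
      rw [huapp, sub_smul]; abel
    have h3 : ‖S f - z • f‖ ≤ ‖w - z‖ * ‖f‖ + ‖(u : E →L[ℂ] E) f‖ := by
      rw [h2, ← norm_smul]; exact norm_sub_le _ _
    have h4 : ‖w - z‖ * ‖f‖ ≤ ε / 4 * ‖f‖ := by gcongr
    have := norm_nonneg f
    nlinarith
  have hinv : ‖((u⁻¹ : (E →L[ℂ] E)ˣ) : E →L[ℂ] E)‖ ≤ 2 / ε := by
    refine ContinuousLinearMap.opNorm_le_bound _ (by positivity) fun f => ?_
    have h1 := hlow (((u⁻¹ : (E →L[ℂ] E)ˣ) : E →L[ℂ] E) f)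
    have h2 : (u : E →L[ℂ] E) (((u⁻¹ : (E →L[ℂ] E)ˣ) : E →L[ℂ] E) f) = f := by
      rw [← mul_apply_eq_comp, u.mul_inv]; rfl
    rw [h2] at h1
    rw [div_mul_eq_mul_div, le_div_iff₀ hε]
    linarith
  refine (spectrum.mem_iff.1 hz) ?_
  have hclose : ‖(algebraMap ℂ (E →L[ℂ] E) z - S) - (u : E →L[ℂ] E)‖
      < ‖((u⁻¹ : (E →L[ℂ] E)ˣ) : E →L[ℂ] E)‖⁻¹ := by
    have h1 : (algebraMap ℂ (E →L[ℂ] E) z - S) - (u : E →L[ℂ] E)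
        = algebraMap ℂ (E →L[ℂ] E) (z - w) := by
      rw [hu, map_sub]; abel
    rw [h1, norm_algebraMap', norm_sub_rev]
    have h2 : 0 < ‖((u⁻¹ : (E →L[ℂ] E)ˣ) : E →L[ℂ] E)‖ := norm_pos_iff.2 u⁻¹.ne_zero
    refine hwz.trans_lt ((show ε / 4 < (2 / ε)⁻¹ by rw [inv_div]; linarith).trans_le ?_)
    exact inv_anti₀ h2 hinv
  exact (u.ofNearby _ hclose).isUnit

/-- If the powers of a power bounded operator do not tend to `0` in norm, the operator has an
approximate eigenvalue of modulus one. -/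
theorem exists_approximate_eigenvalue [Nontrivial E] (S : E →L[ℂ] E) {C : ℝ}
    (hC : ∀ n : ℕ, ‖S ^ n‖ ≤ C) (hS : ¬ Tendsto (fun n : ℕ => ‖S ^ n‖) atTop (𝓝 0)) :
    ∃ z : ℂ, ‖z‖ = 1 ∧ ∀ ε : ℝ, 0 < ε → ∃ f : E, ‖f‖ = 1 ∧ ‖S f - z • f‖ < ε := by
  obtain ⟨z, hz, hzr⟩ := spectrum.exists_nnnorm_eq_spectralRadius S
  have hmax : ∀ w ∈ spectrum ℂ S, ‖w‖ ≤ ‖z‖ := fun w hw => by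
    have h1 : (‖w‖₊ : ENNReal) ≤ spectralRadius ℂ S := le_iSup₂ (α := ENNReal) w hw
    rw [← hzr] at h1
    exact_mod_cast h1
  have hle : ‖z‖ ≤ 1 := by
    by_contra! h
    obtain ⟨n, hn⟩ := pow_unbounded_of_one_lt C h
    have h1 := spectrum.norm_le_norm_of_mem (spectrum.pow_mem_pow S n hz)
    rw [norm_pow] at h1
    linarith [hC n]
  have hge : 1 ≤ ‖z‖ := by
    by_contra! h
    refine hS ?_
    obtain ⟨q, hzq, hq⟩ := exists_between h
    have hq0 : 0 ≤ q := (norm_nonneg z).trans hzq.le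
    have hlt : spectralRadius ℂ S < ENNReal.ofReal q := by
      rw [← hzr, ← enorm_eq_nnnorm, ← ofReal_norm]
      exact (ENNReal.ofReal_lt_ofReal_iff (by linarith [norm_nonneg z])).2 hzq
    have hev := (tendsto_order.1
      (spectrum.pow_norm_pow_one_div_tendsto_nhds_spectralRadius S)).2 _ hlt
    refine squeeze_zero' (Eventually.of_forall fun n => norm_nonneg _) ?_
      (tendsto_pow_atTop_nhds_zero_of_lt_one hq0 hq)
    filter_upwards [hev, eventually_gt_atTop 0] with n hn hn0
    have h1 := (ENNReal.ofReal_lt_ofReal_iff_of_nonneg (by positivity)).1 hn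
    calc ‖S ^ n‖ = (‖S ^ n‖ ^ (1 / (n : ℝ))) ^ n := by
          rw [one_div, Real.rpow_inv_natCast_pow (norm_nonneg _) hn0.ne']
      _ ≤ q ^ n := pow_le_pow_left₀ (by positivity) h1.le n
  have h1 : ‖z‖ = 1 := le_antisymm hle hge
  refine ⟨z, h1, fun ε hε => ?_⟩
  obtain ⟨f, hf⟩ := exists_norm_map_sub_smul_lt S hz hmax (norm_pos_iff.1 (by linarith)) hε
  have hf0 : 0 < ‖f‖ := by
    by_contra! h
    have := norm_nonneg (S f - z • f)
    nlinarith [norm_nonneg f]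
  refine ⟨((‖f‖⁻¹ : ℝ) : ℂ) • f, ?_, ?_⟩
  · rw [norm_smul, Complex.norm_real, norm_inv, norm_norm, inv_mul_cancel₀ hf0.ne']
  · rw [map_smul, smul_comm z, ← smul_sub, norm_smul, Complex.norm_real, norm_inv, norm_norm,
      inv_mul_lt_iff₀ hf0, mul_comm]
    exact hf

end ApproximateEigenvector

end

noncomputable section

namespace GenMarkov

variable {X : Type*} [MeasurableSpace X] {κ : Kernel X X} [IsMarkovKernel κ] {m : Measure X}
  [IsProbabilityMeasure m]

/-! ### The kernel acting on complex bounded measurable functions -/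

theorem integrable_of_forall_norm_le {f : X → ℂ} (hf : Measurable f) {C : ℝ}
    (hC : ∀ x, ‖f x‖ ≤ C) (p : Measure X) [IsFiniteMeasure p] : Integrable f p :=
  Integrable.of_bound hf.aestronglyMeasurable C (ae_of_all _ hC)

theorem measurable_integral_kernel (κ : Kernel X X) [IsMarkovKernel κ] {f : X → ℂ}
    (hf : Measurable f) : Measurable fun x => ∫ y, f y ∂κ x :=
  (hf.stronglyMeasurable.integral_kernel (κ := κ)).measurable

theorem norm_integral_le_of_forall_norm_le {f : X → ℂ} {C : ℝ} (hC : ∀ x, ‖f x‖ ≤ C)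
    (p : Measure X) [IsProbabilityMeasure p] : ‖∫ x, f x ∂p‖ ≤ C := by
  simpa using norm_integral_le_of_norm_le_const (μ := p) (ae_of_all _ hC)

theorem integral_kernel_pow_zero (κ : Kernel X X) [IsMarkovKernel κ] (x : X) {F : Type*}
    [NormedAddCommGroup F] [NormedSpace ℝ F] [CompleteSpace F] {f : X → F}
    (hf : StronglyMeasurable f) : ∫ y, f y ∂(κ ^ 0) x = f x := by
  rw [pow_zero, show (1 : Kernel X X) = Kernel.id from rfl, Kernel.id_apply, integral_dirac' _ _ hf]

theorem invariant_of_markovOp_eq (h : markovOp κ (BA.ofMeasure m) = BA.ofMeasure m) :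
    κ.Invariant m := by
  refine Measure.ext fun E hE => ?_
  have h1 : (markovOp κ (BA.ofMeasure m)) E = BA.ofMeasure m E := by rw [h]
  rw [markovOp_apply κ _ hE, BA.ofMeasure_integral m (bddMeas_kernel_real κ hE),
    BA.ofMeasure_apply m hE] at h1
  simp only [measureReal_def] at h1
  have hle : ∫⁻ x, κ x E ∂m ≤ 1 :=
    (lintegral_mono fun x => prob_le_one).trans_eq (by simp)
  rw [integral_toReal (κ.measurable_coe hE).aemeasurable
    (ae_of_all _ fun x => measure_lt_top _ _)] at h1
  rw [Measure.bind_apply hE κ.aemeasurable]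
  exact (ENNReal.toReal_eq_toReal_iff' (hle.trans_lt ENNReal.one_lt_top).ne
    (measure_ne_top m E)).1 h1

theorem integral_integral_kernel {κ : Kernel X X} (hinv : κ.Invariant m) {F : Type*} [NormedAddCommGroup F]
    [NormedSpace ℝ F] {f : X → F} (hf : Integrable f m) :
    ∫ x, ∫ y, f y ∂κ x ∂m = ∫ x, f x ∂m := by
  obtain ⟨x₀⟩ : Nonempty X := m.nonempty_of_neZero
  have h := Kernel.integral_comp (κ := Kernel.const X m) (η := κ) (a := x₀) (f := f)
    (by rw [hinv.comp_const, Kernel.const_apply]; exact hf)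
  rw [hinv.comp_const, Kernel.const_apply] at h
  exact h.symm

theorem norm_pow_sub_pow_le {a b : ℂ} (ha : ‖a‖ ≤ 1) (hb : ‖b‖ ≤ 1) (k : ℕ) :
    ‖a ^ k - b ^ k‖ ≤ k * ‖a - b‖ := by
  induction k with
  | zero => simp
  | succ k ih =>
    have h1 : a ^ (k + 1) - b ^ (k + 1) = a ^ k * (a - b) + (a ^ k - b ^ k) * b := by ring
    rw [h1]
    refine (norm_add_le _ _).trans ?_
    rw [norm_mul, norm_mul, norm_pow]
    have h2 : ‖a‖ ^ k ≤ 1 := pow_le_one₀ (norm_nonneg _) ha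
    have h3 := norm_nonneg (a - b)
    have h4 := norm_nonneg (a ^ k - b ^ k)
    push_cast
    nlinarith

/-- The powers of a complex number of modulus one return to every neighbourhood of `1`. -/
theorem exists_norm_pow_sub_one_lt {z : ℂ} (hz : ‖z‖ = 1) {δ : ℝ} (hδ : 0 < δ) :
    ∃ k : ℕ, 1 ≤ k ∧ ‖z ^ k - 1‖ < δ := by
  obtain ⟨a, -, φ, hφ, hlim⟩ := (isCompact_closedBall (0 : ℂ) 1).tendsto_subseq
    (x := fun n => z ^ n) fun n => by simp [hz]
  obtain ⟨N, hN⟩ := Metric.cauchySeq_iff'.1 hlim.cauchySeq δ hδ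
  have h1 := hN (N + 1) (by omega)
  have h2 : φ N < φ (N + 1) := hφ (by omega)
  refine ⟨φ (N + 1) - φ N, by omega, ?_⟩
  have h3 : z ^ φ (N + 1) - z ^ φ N = z ^ φ N * (z ^ (φ (N + 1) - φ N) - 1) := by
    rw [mul_sub, ← pow_add, Nat.add_sub_cancel' h2.le, mul_one]
  simp only [Function.comp_apply, dist_eq_norm] at h1
  rwa [h3, norm_mul, norm_pow, hz, one_pow, one_mul] at h1

theorem integral_kernel_pow_succ_sub (κ : Kernel X X) [IsMarkovKernel κ] {f : X → ℂ}
    (hf : Measurable f) {C : ℝ} (hC : ∀ x, ‖f x‖ ≤ C) (z : ℂ) (k : ℕ) (x : X) :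
    ∫ y, f y ∂(κ ^ (k + 1)) x - z ^ (k + 1) * f x
      = ∫ u, (∫ y, f y ∂(κ ^ k) u - z ^ k * f u) ∂κ x + z ^ k * (∫ y, f y ∂κ x - z * f x) := by
  rw [integral_kernel_pow_succ κ k x (integrable_of_forall_norm_le hf hC _),
    integral_sub (integrable_of_forall_norm_le (measurable_integral_kernel (κ ^ k) hf)
      (fun u => norm_integral_le_of_forall_norm_le hC _) _)
      ((integrable_of_forall_norm_le hf hC _).const_mul _), MeasureTheory.integral_const_mul]
  ring

/-- An approximate eigenfunction of the kernel is one of its powers, in the sup norm. -/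
theorem norm_integral_kernel_pow_sub_le {f : X → ℂ} (hf : Measurable f) {C : ℝ}
    (hC : ∀ x, ‖f x‖ ≤ C) {z : ℂ} (hz : ‖z‖ = 1) {ε : ℝ}
    (h : ∀ x, ‖∫ y, f y ∂κ x - z * f x‖ ≤ ε) (k : ℕ) (x : X) :
    ‖∫ y, f y ∂(κ ^ k) x - z ^ k * f x‖ ≤ k * ε := by
  induction k generalizing x with
  | zero => rw [integral_kernel_pow_zero κ x hf.stronglyMeasurable]; simp
  | succ k ih =>
    rw [integral_kernel_pow_succ_sub κ hf hC]
    refine (norm_add_le _ _).trans ?_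
    rw [norm_mul, norm_pow, hz, one_pow, one_mul]
    have := norm_integral_le_of_forall_norm_le ih (κ x)
    have := h x
    push_cast
    linarith

/-- An approximate eigenfunction of the kernel is one of its powers, in `L¹` of an invariant
probability measure. -/
theorem integral_norm_kernel_pow_sub_le (hinv : κ.Invariant m) {f : X → ℂ} (hf : Measurable f)
    {C : ℝ} (hC : ∀ x, ‖f x‖ ≤ C) {z : ℂ} (hz : ‖z‖ = 1) {β : ℝ}
    (h : ∫ x, ‖∫ y, f y ∂κ x - z * f x‖ ∂m ≤ β) (k : ℕ) :
    ∫ x, ‖∫ y, f y ∂(κ ^ k) x - z ^ k * f x‖ ∂m ≤ k * β := by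
  have hmeas : ∀ k, Measurable fun x => ∫ y, f y ∂(κ ^ k) x - z ^ k * f x := fun k =>
    (measurable_integral_kernel (κ ^ k) hf).sub (hf.const_mul _)
  have hbd : ∀ k x, ‖∫ y, f y ∂(κ ^ k) x - z ^ k * f x‖ ≤ C + C := fun k x => by
    refine (norm_sub_le _ _).trans
      (add_le_add (norm_integral_le_of_forall_norm_le hC _) ?_)
    rw [norm_mul, norm_pow, hz, one_pow, one_mul]
    exact hC x
  have hint : ∀ k (p : Measure X) [IsProbabilityMeasure p],
      Integrable (fun x => ‖∫ y, f y ∂(κ ^ k) x - z ^ k * f x‖) p := fun k p _ =>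
    (integrable_of_forall_norm_le (hmeas k) (hbd k) p).norm
  have hint1 : Integrable (fun x => ‖∫ y, f y ∂κ x - z * f x‖) m := by
    simpa using hint 1 m
  induction k with
  | zero =>
    have h0 : ∀ x, ∫ y, f y ∂(κ ^ 0) x = f x := fun x =>
      integral_kernel_pow_zero κ x hf.stronglyMeasurable
    simp only [h0]
    simp
  | succ k ih =>
    have hP : Integrable (fun x => ∫ u, ‖∫ y, f y ∂(κ ^ k) u - z ^ k * f u‖ ∂κ x) m :=
      (BddMeas.kernel κ ⟨(hmeas k).norm, C + C, fun x => by
        rw [abs_of_nonneg (norm_nonneg _)]; exact hbd k x⟩).integrable m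
    calc ∫ x, ‖∫ y, f y ∂(κ ^ (k + 1)) x - z ^ (k + 1) * f x‖ ∂m
        ≤ ∫ x, (∫ u, ‖∫ y, f y ∂(κ ^ k) u - z ^ k * f u‖ ∂κ x
            + ‖∫ y, f y ∂κ x - z * f x‖) ∂m := by
          refine integral_mono (hint (k + 1) m) (hP.add hint1) fun x => ?_
          simp only
          rw [integral_kernel_pow_succ_sub κ hf hC]
          refine (norm_add_le _ _).trans (add_le_add (norm_integral_le_integral_norm _) ?_)
          rw [norm_mul, norm_pow, hz, one_pow, one_mul]
      _ = ∫ x, ‖∫ y, f y ∂(κ ^ k) x - z ^ k * f x‖ ∂m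
            + ∫ x, ‖∫ y, f y ∂κ x - z * f x‖ ∂m := by
          rw [integral_add hP hint1, integral_integral_kernel hinv (hint k m)]
      _ ≤ _ := by push_cast; linarith

/-! ### The spectral gap of the Cesàro means on functions -/

/-- The `n`-th Cesàro mean maps every complex function bounded by `1` to within `δ` of its integral
with respect to `m`. -/
def MeanGap (κ : Kernel X X) (m : Measure X) (n : ℕ) (δ : ℝ) : Prop :=
  ∀ f : X → ℂ, Measurable f → (∀ x, ‖f x‖ ≤ 1) → ∀ x,
    ‖(1 / (n : ℝ)) • ∑ k ∈ Finset.Icc 1 n, ∫ y, f y ∂(κ ^ k) x - ∫ y, f y ∂m‖ ≤ δ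

theorem exists_meanGap (hμ : Deltaba κ = {BA.ofMeasure m}) {δ : ℝ} (hδ : 0 < δ) :
    ∃ n : ℕ, 1 ≤ n ∧ MeanGap κ m n δ := by
  obtain ⟨N, hN⟩ := exists_forall_norm_cesaro_sub_lt hμ (half_pos hδ)
  refine ⟨N + 1, by omega, fun f hf hf1 x => ?_⟩
  have hreal : ∀ g : X → ℝ, Measurable g → (∀ x, |g x| ≤ 1) →
      |1 / ((N + 1 : ℕ) : ℝ) * ∑ k ∈ Finset.Icc 1 (N + 1), ∫ y, g y ∂(κ ^ k) x
        - ∫ y, g y ∂m| ≤ δ / 2 := fun g hg hg1 => by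
    have h1 := hN (N + 1) (by omega) _ (BA.ofMeasure_mem_Sba (Measure.dirac x))
    rw [← cesaro_dirac_integral κ _ x ⟨hg, 1, hg1⟩, ← BA.ofMeasure_integral m ⟨hg, 1, hg1⟩,
      ← BA.sub_integral _ _ ⟨hg, 1, hg1⟩]
    refine (BA.abs_integral_le _ hg zero_le_one hg1).trans ?_
    rw [one_mul]
    exact h1.le
  have hint : ∀ (p : Measure X) [IsProbabilityMeasure p], Integrable f p := fun p _ =>
    integrable_of_forall_norm_le hf hf1 p
  have hre := hreal (fun x => (f x).re) (Complex.measurable_re.comp hf) fun x =>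
    (Complex.abs_re_le_norm _).trans (hf1 x)
  have him := hreal (fun x => (f x).im) (Complex.measurable_im.comp hf) fun x =>
    (Complex.abs_im_le_norm _).trans (hf1 x)
  have hre' : ∀ (p : Measure X) [IsProbabilityMeasure p],
      ∫ y, (f y).re ∂p = (∫ y, f y ∂p).re := fun p _ => integral_re (hint p)
  have him' : ∀ (p : Measure X) [IsProbabilityMeasure p],
      ∫ y, (f y).im ∂p = (∫ y, f y ∂p).im := fun p _ => integral_im (hint p)
  simp only [hre', him'] at hre him
  refine (Complex.norm_le_abs_re_add_abs_im _).trans ?_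
  rw [Complex.sub_re, Complex.sub_im, Complex.smul_re, Complex.smul_im, Complex.re_sum,
    Complex.im_sum, smul_eq_mul, smul_eq_mul]
  linarith

/-- The modulus of an approximate eigenfunction is almost bounded by its mean. -/
theorem norm_le_integral_norm_add {m : Measure X} {n : ℕ} {δ : ℝ} (hn : 1 ≤ n) (hgap : MeanGap κ m n δ)
    {f : X → ℂ} (hf : Measurable f) (hf1 : ∀ x, ‖f x‖ ≤ 1) {z : ℂ} (hz : ‖z‖ = 1) {ε : ℝ}
    (h : ∀ x, ‖∫ y, f y ∂κ x - z * f x‖ ≤ ε) (x : X) :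
    ‖f x‖ ≤ ∫ y, ‖f y‖ ∂m + δ + n * ε := by
  have hε : 0 ≤ ε := (norm_nonneg _).trans (h x)
  have hn0 : (0 : ℝ) < n := by exact_mod_cast hn
  have h1 : ∀ k ∈ Finset.Icc 1 n, ‖f x‖ - n * ε ≤ ∫ y, ‖f y‖ ∂(κ ^ k) x := fun k hk => by
    have h2 := norm_integral_kernel_pow_sub_le hf hf1 hz h k x
    have h3 : ‖f x‖ ≤ ‖∫ y, f y ∂(κ ^ k) x‖ + k * ε := by
      have h4 : ‖z ^ k * f x‖ = ‖f x‖ := by rw [norm_mul, norm_pow, hz, one_pow, one_mul]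
      have h5 := norm_sub_norm_le (z ^ k * f x) (∫ y, f y ∂(κ ^ k) x)
      rw [norm_sub_rev] at h5
      linarith
    have h6 : (k : ℝ) * ε ≤ n * ε := by
      gcongr
      exact (Finset.mem_Icc.1 hk).2
    linarith [norm_integral_le_integral_norm (μ := (κ ^ k) x) f]
  have h2 := hgap (fun x => (‖f x‖ : ℂ)) (Complex.measurable_ofReal.comp hf.norm)
    (fun x => by simpa using hf1 x) x
  simp only [integral_complex_ofReal] at h2
  rw [← Complex.ofReal_sum, Complex.real_smul, ← Complex.ofReal_mul, ← Complex.ofReal_sub,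
    Complex.norm_real, Real.norm_eq_abs] at h2
  have h3 : ‖f x‖ - n * ε ≤ 1 / (n : ℝ) * ∑ k ∈ Finset.Icc 1 n, ∫ y, ‖f y‖ ∂(κ ^ k) x := by
    rw [one_div, le_inv_mul_iff₀ hn0]
    have := Finset.card_nsmul_le_sum _ _ _ h1
    rw [Nat.card_Icc, Nat.add_sub_cancel, nsmul_eq_mul] at this
    exact this
  linarith [(abs_le.1 h2).2]

/-- The `L¹` error in `P (f ^ k) ≈ z ^ k f ^ k` for an approximate eigenfunction `f`. It comes from
`∬ |f y - z f x|² κ(x, dy) m(dx) ≤ 2 ε` and `t ≤ t² / s + s`. -/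
theorem integral_norm_kernel_pow_function_sub_le (hinv : κ.Invariant m) {f : X → ℂ}
    (hf : Measurable f) (hf1 : ∀ x, ‖f x‖ ≤ 1) {z : ℂ} (hz : ‖z‖ = 1) {ε : ℝ}
    (h : ∀ x, ‖∫ y, f y ∂κ x - z * f x‖ ≤ ε) (k : ℕ) {s : ℝ} (hs : 0 < s) :
    ∫ x, ‖∫ y, f y ^ k ∂κ x - z ^ k * f x ^ k‖ ∂m ≤ k * (2 * ε / s + s) := by
  have hsq : BddMeas fun x => ‖f x‖ ^ 2 := ⟨hf.norm.pow_const 2, 1, fun x => by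
    rw [abs_of_nonneg (by positivity)]; exact pow_le_one₀ (norm_nonneg _) (hf1 x)⟩
  have hfk1 : ∀ x, ‖f x ^ k‖ ≤ 1 := fun x => by
    rw [norm_pow]; exact pow_le_one₀ (norm_nonneg _) (hf1 x)
  have hfk : Measurable fun x => f x ^ k := hf.pow_const k
  have hpt : ∀ x, ‖∫ y, f y ^ k ∂κ x - z ^ k * f x ^ k‖
      ≤ k * ((∫ y, ‖f y‖ ^ 2 ∂κ x - ‖f x‖ ^ 2 + 2 * ε) / s + s) := by
    intro x
    have hzf : ‖z * f x‖ = ‖f x‖ := by rw [norm_mul, hz, one_mul]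
    set c : ℂ := (starRingEnd ℂ) (z * f x) with hc
    have hcint : Integrable (fun y => c * f y) (κ x) :=
      (integrable_of_forall_norm_le hf hf1 _).const_mul c
    have hquad : ∀ y, ‖f y - z * f x‖ ^ 2 = ‖f y‖ ^ 2 + ‖f x‖ ^ 2 - 2 * (c * f y).re := fun y => by
      rw [← hzf, ← Complex.normSq_eq_norm_sq, ← Complex.normSq_eq_norm_sq,
        ← Complex.normSq_eq_norm_sq, Complex.normSq_sub, hc, mul_comm (f y)]
    have hi1 : Integrable (fun y => ‖f y - z * f x‖ ^ 2) (κ x) := by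
      simp only [hquad]
      exact ((hsq.integrable _).add (integrable_const _)).sub (hcint.re.const_mul 2)
    have hval : ∫ y, ‖f y - z * f x‖ ^ 2 ∂κ x
        = ∫ y, ‖f y‖ ^ 2 ∂κ x + ‖f x‖ ^ 2 - 2 * (c * ∫ y, f y ∂κ x).re := by
      simp only [hquad]
      have hci : Integrable (fun y => 2 * (c * f y).re) (κ x) := hcint.re.const_mul 2
      have hsi : Integrable (fun y => ‖f y‖ ^ 2 + ‖f x‖ ^ 2) (κ x) :=
        (hsq.integrable _).add (integrable_const _)
      rw [integral_sub hsi hci, integral_add (hsq.integrable _) (integrable_const _),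
        MeasureTheory.integral_const_mul, integral_const, probReal_univ, one_smul,
        ← MeasureTheory.integral_const_mul c]
      congr 2
      exact integral_re hcint
    have hre : ‖f x‖ ^ 2 - ε ≤ (c * ∫ y, f y ∂κ x).re := by
      have h1 : c * ∫ y, f y ∂κ x = ((‖f x‖ ^ 2 : ℝ) : ℂ) + c * (∫ y, f y ∂κ x - z * f x) := by
        have h2 : c * (z * f x) = ((‖f x‖ ^ 2 : ℝ) : ℂ) := by
          rw [hc, mul_comm, Complex.mul_conj, Complex.normSq_eq_norm_sq, hzf]
        rw [← h2]; ring
      rw [h1, Complex.add_re, Complex.ofReal_re]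
      have h3 : ‖c * (∫ y, f y ∂κ x - z * f x)‖ ≤ ε := by
        rw [norm_mul, hc, Complex.norm_conj, hzf]
        have := h x
        have := hf1 x
        nlinarith [norm_nonneg (f x), norm_nonneg (∫ y, f y ∂κ x - z * f x)]
      have h4 := (abs_le.1 (Complex.abs_re_le_norm (c * (∫ y, f y ∂κ x - z * f x)))).1
      linarith
    have hbound : ∫ y, ‖f y - z * f x‖ ^ 2 ∂κ x
        ≤ ∫ y, ‖f y‖ ^ 2 ∂κ x - ‖f x‖ ^ 2 + 2 * ε := by
      rw [hval]; linarith
    have hi2 : Integrable (fun y => (k : ℝ) * (‖f y - z * f x‖ ^ 2 / s + s)) (κ x) :=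
      ((hi1.div_const s).add (integrable_const s)).const_mul _
    have hdiff : ∫ y, f y ^ k ∂κ x - z ^ k * f x ^ k = ∫ y, (f y ^ k - (z * f x) ^ k) ∂κ x := by
      rw [integral_sub (integrable_of_forall_norm_le hfk hfk1 _) (integrable_const _),
        integral_const, probReal_univ, one_smul, mul_pow]
    calc ‖∫ y, f y ^ k ∂κ x - z ^ k * f x ^ k‖
        ≤ ∫ y, (k : ℝ) * (‖f y - z * f x‖ ^ 2 / s + s) ∂κ x := by
          rw [hdiff]
          refine norm_integral_le_of_norm_le hi2 (ae_of_all _ fun y => ?_)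
          refine (norm_pow_sub_pow_le (hf1 y) (hzf.le.trans (hf1 x)) k).trans ?_
          gcongr
          have h0 := norm_nonneg (f y - z * f x)
          rw [← sub_le_iff_le_add, le_div_iff₀ hs]
          nlinarith [sq_nonneg (‖f y - z * f x‖ - s)]
      _ = k * ((∫ y, ‖f y - z * f x‖ ^ 2 ∂κ x) / s + s) := by
          rw [MeasureTheory.integral_const_mul, integral_add (hi1.div_const s) (integrable_const s),
            integral_div, integral_const, probReal_univ, one_smul]
      _ ≤ _ := by gcongr
  have hi0 : Integrable (fun x => ∫ y, ‖f y‖ ^ 2 ∂κ x - ‖f x‖ ^ 2) m :=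
    ((hsq.kernel κ).integrable m).sub (hsq.integrable m)
  have hi : Integrable
      (fun x => k * ((∫ y, ‖f y‖ ^ 2 ∂κ x - ‖f x‖ ^ 2 + 2 * ε) / s + s)) m :=
    (((hi0.add (integrable_const _)).div_const s).add (integrable_const s)).const_mul _
  have hz0 : ∫ x, (∫ y, ‖f y‖ ^ 2 ∂κ x - ‖f x‖ ^ 2) ∂m = 0 := by
    rw [integral_sub ((hsq.kernel κ).integrable m) (hsq.integrable m),
      integral_integral_kernel hinv (hsq.integrable m), sub_self]
  refine (integral_mono_of_nonneg (ae_of_all _ fun x => norm_nonneg _) hi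
    (ae_of_all _ hpt)).trans_eq ?_
  have hi1 : Integrable (fun x => (∫ y, ‖f y‖ ^ 2 ∂κ x - ‖f x‖ ^ 2 + 2 * ε) / s) m :=
    (hi0.add (integrable_const _)).div_const s
  rw [MeasureTheory.integral_const_mul, integral_add hi1 (integrable_const s), integral_div,
    integral_add hi0 (integrable_const _), hz0, integral_const, integral_const, probReal_univ,
    one_smul, one_smul, zero_add]

/-- The size of an `L¹` approximate eigenfunction with eigenvalue close to, but different from,
`1`. -/
theorem integral_norm_le_of_meanGap (hinv : κ.Invariant m) {n : ℕ} {δ : ℝ} (hn : 1 ≤ n)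
    (hgap : MeanGap κ m n δ) {f : X → ℂ} (hf : Measurable f) (hf1 : ∀ x, ‖f x‖ ≤ 1) {z : ℂ}
    (hz : ‖z‖ = 1) (hz1 : z ≠ 1) {β : ℝ} (hβ : ∫ x, ‖∫ y, f y ∂κ x - z * f x‖ ∂m ≤ β) :
    ∫ x, ‖f x‖ ∂m ≤ β / ‖1 - z‖ + δ + n * (β + ‖z - 1‖) := by
  have hn0 : (0 : ℝ) < n := by exact_mod_cast hn
  have hfi := integrable_of_forall_norm_le hf hf1 m
  have hPm := measurable_integral_kernel κ hf
  have hPb : ∀ x, ‖∫ y, f y ∂κ x‖ ≤ 1 := fun x => norm_integral_le_of_forall_norm_le hf1 _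
  have hPi := integrable_of_forall_norm_le hPm hPb m
  have hβ0 : 0 ≤ β := (integral_nonneg fun x => norm_nonneg _).trans hβ
  -- the mean of `f` is small because `1` is an exact eigenvalue of the dual operator
  have hmean : ‖∫ x, f x ∂m‖ ≤ β / ‖1 - z‖ := by
    rw [le_div_iff₀ (norm_pos_iff.2 (sub_ne_zero.2 hz1.symm)), ← norm_mul]
    have h1 : (∫ x, f x ∂m) * (1 - z) = ∫ x, (∫ y, f y ∂κ x - z * f x) ∂m := by
      rw [integral_sub hPi (hfi.const_mul z), integral_integral_kernel hinv hfi,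
        MeasureTheory.integral_const_mul]
      ring
    rw [h1]
    exact (norm_integral_le_integral_norm _).trans hβ
  have hd : ∀ k, Integrable (fun x => ‖∫ y, f y ∂(κ ^ k) x - f x‖) m := fun k =>
    ((integrable_of_forall_norm_le (measurable_integral_kernel (κ ^ k) hf)
      (fun x => norm_integral_le_of_forall_norm_le hf1 _) m).sub hfi).norm
  have hdle : ∀ k ∈ Finset.Icc 1 n,
      ∫ x, ‖∫ y, f y ∂(κ ^ k) x - f x‖ ∂m ≤ n * (β + ‖z - 1‖) := fun k hk => by
    have hkn : (k : ℝ) ≤ n := by exact_mod_cast (Finset.mem_Icc.1 hk).2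
    have h1 := integral_norm_kernel_pow_sub_le hinv hf hf1 hz hβ k
    have h2 : ‖z ^ k - 1‖ ≤ k * ‖z - 1‖ := by
      simpa using norm_pow_sub_pow_le hz.le (b := 1) (by simp) k
    have h3 : Integrable (fun x => ‖∫ y, f y ∂(κ ^ k) x - z ^ k * f x‖) m :=
      ((integrable_of_forall_norm_le (measurable_integral_kernel (κ ^ k) hf)
        (fun x => norm_integral_le_of_forall_norm_le hf1 _) m).sub (hfi.const_mul _)).norm
    calc ∫ x, ‖∫ y, f y ∂(κ ^ k) x - f x‖ ∂m
        ≤ ∫ x, (‖∫ y, f y ∂(κ ^ k) x - z ^ k * f x‖ + k * ‖z - 1‖) ∂m := by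
          refine integral_mono (hd k) (h3.add (integrable_const _)) fun x => ?_
          have h4 : ∫ y, f y ∂(κ ^ k) x - f x
              = (∫ y, f y ∂(κ ^ k) x - z ^ k * f x) + (z ^ k - 1) * f x := by ring
          simp only
          rw [h4]
          refine (norm_add_le _ _).trans (add_le_add le_rfl ?_)
          rw [norm_mul]
          calc ‖z ^ k - 1‖ * ‖f x‖ ≤ ‖z ^ k - 1‖ * 1 := by gcongr; exact hf1 x
            _ ≤ _ := by rw [mul_one]; exact h2
      _ = ∫ x, ‖∫ y, f y ∂(κ ^ k) x - z ^ k * f x‖ ∂m + k * ‖z - 1‖ := by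
          rw [integral_add h3 (integrable_const _), integral_const, probReal_univ, one_smul]
      _ ≤ k * β + k * ‖z - 1‖ := by linarith
      _ ≤ n * (β + ‖z - 1‖) := by rw [← mul_add]; gcongr
  have hsumi : Integrable
      (fun x => ∑ k ∈ Finset.Icc 1 n, ‖∫ y, f y ∂(κ ^ k) x - f x‖) m :=
    integrable_finsetSum _ fun k _ => hd k
  have hpt : ∀ x, ‖f x‖ ≤ (β / ‖1 - z‖ + δ)
      + 1 / (n : ℝ) * ∑ k ∈ Finset.Icc 1 n, ‖∫ y, f y ∂(κ ^ k) x - f x‖ := fun x => by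
    have h1 := hgap f hf hf1 x
    set a := (1 / (n : ℝ)) • ∑ k ∈ Finset.Icc 1 n, ∫ y, f y ∂(κ ^ k) x with ha
    have h2 : ‖a - f x‖ ≤ 1 / (n : ℝ) * ∑ k ∈ Finset.Icc 1 n, ‖∫ y, f y ∂(κ ^ k) x - f x‖ := by
      have h3 : a - f x = (1 / (n : ℝ)) • ∑ k ∈ Finset.Icc 1 n, (∫ y, f y ∂(κ ^ k) x - f x) := by
        rw [Finset.sum_sub_distrib, smul_sub, Finset.sum_const, Nat.card_Icc, Nat.add_sub_cancel,
          ← Nat.cast_smul_eq_nsmul ℝ, smul_smul, one_div, inv_mul_cancel₀ hn0.ne', one_smul, ha,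
          one_div]
      rw [h3, norm_smul, Real.norm_eq_abs, abs_of_pos (by positivity)]
      gcongr
      exact norm_sum_le _ _
    have h3 : f x = ∫ y, f y ∂m + (a - ∫ y, f y ∂m) - (a - f x) := by ring
    calc ‖f x‖ ≤ ‖∫ y, f y ∂m‖ + ‖a - ∫ y, f y ∂m‖ + ‖a - f x‖ := by
          nth_rewrite 1 [h3]
          exact (norm_sub_le _ _).trans (add_le_add (norm_add_le _ _) le_rfl)
      _ ≤ _ := by linarith
  calc ∫ x, ‖f x‖ ∂m ≤ ∫ x, ((β / ‖1 - z‖ + δ)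
        + 1 / (n : ℝ) * ∑ k ∈ Finset.Icc 1 n, ‖∫ y, f y ∂(κ ^ k) x - f x‖) ∂m :=
        integral_mono hfi.norm ((integrable_const _).add (hsumi.const_mul _)) hpt
    _ = (β / ‖1 - z‖ + δ)
        + 1 / (n : ℝ) * ∑ k ∈ Finset.Icc 1 n, ∫ x, ‖∫ y, f y ∂(κ ^ k) x - f x‖ ∂m := by
        rw [integral_add (integrable_const _) (hsumi.const_mul _), integral_const, probReal_univ,
          one_smul, MeasureTheory.integral_const_mul, integral_finsetSum _ fun k _ => hd k]
    _ ≤ _ := by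
        refine add_le_add le_rfl ?_
        rw [one_div, inv_mul_le_iff₀ hn0]
        refine (Finset.sum_le_card_nsmul _ _ _ hdle).trans_eq ?_
        rw [Nat.card_Icc, Nat.add_sub_cancel, nsmul_eq_mul]

end GenMarkov

end

noncomputable section

namespace GenMarkov

variable {X : Type*} [MeasurableSpace X] {κ : Kernel X X} [IsMarkovKernel κ] {m : Measure X}
  [IsProbabilityMeasure m]

theorem Deltaba_pow_one (κ : Kernel X X) [IsMarkovKernel κ] : Deltaba (κ ^ 1) = Deltaba κ := by
  rw [Deltaba, Deltaba, markovOp_pow, pow_one]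

/-! ### No peripheral approximate eigenvalues -/

/-- Let `z` have modulus one and let all powers of the kernel have a unique invariant mean. Then
there are no approximate eigenfunctions with eigenvalue `z` and approximate mean `0`. If
`z` is a root of unity, they contradict the convergence of the Cesàro means of a power of the kernel;
otherwise their powers are approximate eigenfunctions in `L¹` with eigenvalues that
come arbitrarily close to `1` without being `1`. -/
theorem not_forall_exists_approximate_eigenfunction
    (hμ : ∀ d : ℕ, 1 ≤ d → Deltaba (κ ^ d) = {BA.ofMeasure m}) {z : ℂ} (hz : ‖z‖ = 1)
    (happ : ∀ ε : ℝ, 0 < ε → ∃ f : X → ℂ, Measurable f ∧ (∀ x, ‖f x‖ ≤ 1) ∧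
      (∃ x, 1 - ε < ‖f x‖) ∧ (∀ x, ‖∫ y, f y ∂κ x - z * f x‖ ≤ ε) ∧ ‖∫ x, f x ∂m‖ ≤ ε) :
    False := by
  have hμ1 : Deltaba κ = {BA.ofMeasure m} := by rw [← Deltaba_pow_one]; exact hμ 1 le_rfl
  have hinv : κ.Invariant m := invariant_of_markovOp_eq (markovOp_eq_of_unique hμ1)
  by_cases hroot : ∃ k : ℕ, 1 ≤ k ∧ z ^ k = 1
  · obtain ⟨k, hk, hzk⟩ := hroot
    obtain ⟨n, hn, hgap⟩ := exists_meanGap (hμ k hk) (δ := 1 / 8) (by norm_num)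
    have hnk : (0 : ℝ) < n * k := by
      have : 0 < n * k := Nat.mul_pos hn hk
      exact_mod_cast this
    set ε : ℝ := min (1 / 8) (1 / 8 / (n * k)) with hε
    have hε0 : 0 < ε := by positivity
    obtain ⟨f, hf, hf1, ⟨x, hx⟩, hPf, hmean⟩ := happ ε hε0
    have h8 : ε ≤ 1 / 8 := min_le_left _ _
    have hnkε : n * (k * ε) ≤ 1 / 8 := by
      rw [← mul_assoc, mul_comm, ← le_div_iff₀ hnk]
      exact min_le_right _ _
    have hkstep : ∀ x, ‖∫ y, f y ∂(κ ^ k) x - 1 * f x‖ ≤ k * ε := fun x => by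
      rw [← hzk]; exact norm_integral_kernel_pow_sub_le hf hf1 hz hPf k x
    have h1 : ‖(1 / (n : ℝ)) • ∑ j ∈ Finset.Icc 1 n, ∫ y, f y ∂((κ ^ k) ^ j) x - f x‖ ≤ 1 / 8 := by
      refine norm_average_sub_le hn (fun j => ∫ y, f y ∂((κ ^ k) ^ j) x) fun j hj => ?_
      have h2 := norm_integral_kernel_pow_sub_le hf hf1 norm_one hkstep j x
      rw [one_pow, one_mul] at h2
      have h3 : (j : ℝ) ≤ n := by exact_mod_cast (Finset.mem_Icc.1 hj).2
      refine h2.trans (le_trans ?_ hnkε)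
      gcongr
    have h2 := hgap f hf hf1 x
    set a := (1 / (n : ℝ)) • ∑ j ∈ Finset.Icc 1 n, ∫ y, f y ∂((κ ^ k) ^ j) x with ha
    have h3 : ‖f x‖ ≤ ‖∫ y, f y ∂m‖ + ‖a - ∫ y, f y ∂m‖ + ‖a - f x‖ := by
      have h4 : f x = ∫ y, f y ∂m + (a - ∫ y, f y ∂m) - (a - f x) := by ring
      nth_rewrite 1 [h4]
      exact (norm_sub_le _ _).trans (add_le_add (norm_add_le _ _) le_rfl)
    linarith
  · push Not at hroot
    obtain ⟨n, hn, hgap⟩ := exists_meanGap hμ1 (δ := 1 / 16) (by norm_num)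
    have hn0 : (0 : ℝ) < n := by exact_mod_cast hn
    obtain ⟨k, hk, hzk⟩ := exists_norm_pow_sub_one_lt hz (δ := 1 / 8 / n) (by positivity)
    have hk0 : (0 : ℝ) < k := by exact_mod_cast hk
    have hzk1 := hroot k hk
    have hgapz : 0 < ‖1 - z ^ k‖ := norm_pos_iff.2 (sub_ne_zero.2 hzk1.symm)
    -- `b` is the `L¹` error for the `k`-th powers, to be small against the fixed gap `|1 - z ^ k|`
    set b : ℝ := min (‖1 - z ^ k‖ / 8) (1 / 8 / n) with hb
    have hb0 : 0 < b := by positivity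
    set s : ℝ := b / (3 * k) with hs
    have hs0 : 0 < s := by positivity
    obtain ⟨n', hn', hgap'⟩ := exists_meanGap hμ1 (δ := 1 / (16 * k)) (by positivity)
    have hn'0 : (0 : ℝ) < n' := by exact_mod_cast hn'
    set ε : ℝ := min (s ^ 2) (1 / (16 * k) / (n' + 1)) with hε
    have hε0 : 0 < ε := by positivity
    obtain ⟨f, hf, hf1, ⟨x, hx⟩, hPf, hmean⟩ := happ ε hε0
    have hfk : Measurable fun x => f x ^ k := hf.pow_const k
    have hfk1 : ∀ x, ‖f x ^ k‖ ≤ 1 := fun x => by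
      rw [norm_pow]; exact pow_le_one₀ (norm_nonneg _) (hf1 x)
    -- `f` has modulus close to one in the mean, hence so has its `k`-th power
    have hlow : 1 - 1 / (8 * k) ≤ ∫ y, ‖f y‖ ∂m := by
      have h1 := norm_le_integral_norm_add hn' hgap' hf hf1 hz hPf x
      have h2 : (n' + 1) * ε ≤ 1 / (16 * k) := by
        rw [mul_comm, ← le_div_iff₀ (by positivity)]
        exact min_le_right _ _
      have h3 : 1 / (8 * (k : ℝ)) = 1 / (16 * k) + 1 / (16 * k) := by field_simp; norm_num
      linarith
    have hlowk : 7 / 8 ≤ ∫ y, ‖f y ^ k‖ ∂m := by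
      have hfi := (integrable_of_forall_norm_le hf hf1 m).norm
      have h1 : ∫ y, (1 + (k : ℝ) * (‖f y‖ - 1)) ∂m ≤ ∫ y, ‖f y ^ k‖ ∂m := by
        refine integral_mono ((integrable_const _).add
          ((hfi.sub (integrable_const _)).const_mul _))
          (integrable_of_forall_norm_le hfk hfk1 m).norm fun y => ?_
        simp only [norm_pow]
        have := one_add_mul_le_pow (a := ‖f y‖ - 1) (by linarith [norm_nonneg (f y)]) k
        rwa [add_sub_cancel] at this
      have hki : Integrable (fun y => (k : ℝ) * (‖f y‖ - 1)) m :=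
        (hfi.sub (integrable_const _)).const_mul _
      rw [integral_add (integrable_const _) hki,
        MeasureTheory.integral_const_mul, integral_sub hfi (integrable_const _), integral_const,
        probReal_univ, one_smul] at h1
      have h2 : (k : ℝ) * (1 / (8 * k)) = 1 / 8 := by field_simp
      nlinarith
    have herr : ∫ x, ‖∫ y, f y ^ k ∂κ x - z ^ k * f x ^ k‖ ∂m ≤ b := by
      refine (integral_norm_kernel_pow_function_sub_le hinv hf hf1 hz hPf k hs0).trans ?_
      have h1 : ε ≤ s ^ 2 := min_le_left _ _
      have h2 : 2 * ε / s ≤ 2 * s := by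
        rw [div_le_iff₀ hs0]; nlinarith
      have h3 : k * (3 * s) = b := by rw [hs]; field_simp
      rw [← h3]
      gcongr
      linarith
    have hup := integral_norm_le_of_meanGap hinv hn hgap hfk hfk1
      (by rw [norm_pow, hz, one_pow]) hzk1 herr
    have h1 : b / ‖1 - z ^ k‖ ≤ 1 / 8 := by
      rw [div_le_iff₀ hgapz]
      linarith [min_le_left (‖1 - z ^ k‖ / 8) (1 / 8 / (n : ℝ))]
    have h2 : n * (b + ‖z ^ k - 1‖) ≤ 1 / 4 := by
      have h3 : b ≤ 1 / 8 / n := min_le_right _ _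
      have h4 : n * (1 / 8 / n + 1 / 8 / n) = (1 / 4 : ℝ) := by field_simp; norm_num
      rw [← h4]
      gcongr
    linarith

/-! ### The Banach space of bounded measurable functions -/

/-- The complex bounded measurable functions on `X` with the sup norm, as a subspace of the
bounded functions. -/
def bddMeasSubmodule (X : Type*) [MeasurableSpace X] : Submodule ℂ (lp (fun _ : X => ℂ) ⊤) where
  carrier := {f | Measurable f}
  zero_mem' := measurable_zero
  add_mem' := fun hf hg => Measurable.add hf hg
  smul_mem' := fun c _ hf => Measurable.const_smul hf c

theorem isClosed_bddMeasSubmodule :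
    IsClosed (bddMeasSubmodule X : Set (lp (fun _ : X => ℂ) ⊤)) := by
  refine isClosed_of_closure_subset fun f hf => ?_
  obtain ⟨u, hu, hlim⟩ := mem_closure_iff_seq_limit.1 hf
  refine measurable_of_tendsto_metrizable (f := fun n => (u n : X → ℂ)) hu ?_
  refine tendsto_pi_nhds.2 fun x => ?_
  rw [tendsto_iff_norm_sub_tendsto_zero] at hlim ⊢
  exact squeeze_zero (fun n => norm_nonneg _)
    (fun n => lp.norm_apply_le_norm ENNReal.top_ne_zero (u n - f) x) hlim

/-- The Banach space of complex bounded measurable functions on `X` with the sup norm. -/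
def BddMeasFun (X : Type*) [MeasurableSpace X] : Type _ := ↥(bddMeasSubmodule X)

instance : NormedAddCommGroup (BddMeasFun X) :=
  inferInstanceAs (NormedAddCommGroup ↥(bddMeasSubmodule X))

instance : NormedSpace ℂ (BddMeasFun X) := inferInstanceAs (NormedSpace ℂ ↥(bddMeasSubmodule X))

instance : CompleteSpace (BddMeasFun X) :=
  (isClosed_bddMeasSubmodule (X := X)).completeSpace_coe

theorem norm_apply_le_norm (f : BddMeasFun X) (x : X) : ‖f.1 x‖ ≤ ‖f‖ :=
  lp.norm_apply_le_norm ENNReal.top_ne_zero f.1 x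

theorem norm_le_of_forall_apply_le (f : BddMeasFun X) {C : ℝ} (hC : 0 ≤ C)
    (h : ∀ x, ‖f.1 x‖ ≤ C) : ‖f‖ ≤ C := lp.norm_le_of_forall_le hC h

/-- A bounded measurable function as an element of `BddMeasFun X`. -/
def toBddMeas (f : X → ℂ) (hf : Measurable f) (hb : ∃ C, ∀ x, ‖f x‖ ≤ C) : BddMeasFun X :=
  ⟨⟨f, memℓp_infty (by
    obtain ⟨C, hC⟩ := hb
    exact ⟨C, by rintro _ ⟨x, rfl⟩; exact hC x⟩)⟩, hf⟩

theorem integrable_coe_bddMeas (f : BddMeasFun X) (p : Measure X) [IsFiniteMeasure p] :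
    Integrable (f.1 : X → ℂ) p :=
  integrable_of_forall_norm_le f.2 (norm_apply_le_norm f) p

theorem norm_centered_le (κ : Kernel X X) [IsMarkovKernel κ] (m : Measure X)
    [IsProbabilityMeasure m] (f : BddMeasFun X) (x : X) :
    ‖∫ y, f.1 y ∂κ x - ∫ y, f.1 y ∂m‖ ≤ 2 * ‖f‖ := by
  rw [two_mul]
  exact (norm_sub_le _ _).trans (add_le_add
    (norm_integral_le_of_forall_norm_le (norm_apply_le_norm f) _)
    (norm_integral_le_of_forall_norm_le (norm_apply_le_norm f) _))

/-- The operator `f ↦ ∫ f dκ(x) - ∫ f dm` on bounded measurable functions. -/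
def centeredOp (κ : Kernel X X) [IsMarkovKernel κ] (m : Measure X) [IsProbabilityMeasure m] :
    BddMeasFun X →L[ℂ] BddMeasFun X :=
  LinearMap.mkContinuous
    { toFun := fun f => toBddMeas (fun x => ∫ y, f.1 y ∂κ x - ∫ y, f.1 y ∂m)
        ((measurable_integral_kernel κ f.2).sub measurable_const)
        ⟨2 * ‖f‖, norm_centered_le κ m f⟩
      map_add' := fun f g => by
        refine Subtype.ext (lp.ext (funext fun x => ?_))
        change ∫ y, (f.1 y + g.1 y) ∂κ x - ∫ y, (f.1 y + g.1 y) ∂m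
          = (∫ y, f.1 y ∂κ x - ∫ y, f.1 y ∂m) + (∫ y, g.1 y ∂κ x - ∫ y, g.1 y ∂m)
        rw [integral_add (integrable_coe_bddMeas f _) (integrable_coe_bddMeas g _),
          integral_add (integrable_coe_bddMeas f _) (integrable_coe_bddMeas g _)]
        ring
      map_smul' := fun c f => by
        refine Subtype.ext (lp.ext (funext fun x => ?_))
        change ∫ y, c * f.1 y ∂κ x - ∫ y, c * f.1 y ∂m
          = c * (∫ y, f.1 y ∂κ x - ∫ y, f.1 y ∂m)
        rw [MeasureTheory.integral_const_mul, MeasureTheory.integral_const_mul]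
        ring } 2
    fun f => norm_le_of_forall_apply_le _ (by positivity) (norm_centered_le κ m f)

theorem centeredOp_apply (κ : Kernel X X) [IsMarkovKernel κ] (m : Measure X)
    [IsProbabilityMeasure m] (f : BddMeasFun X) (x : X) :
    (centeredOp κ m f).1 x = ∫ y, f.1 y ∂κ x - ∫ y, f.1 y ∂m := rfl

theorem centeredOp_pow_apply (hinv : κ.Invariant m) (f : BddMeasFun X) (k : ℕ) (x : X) :
    ((centeredOp κ m ^ (k + 1)) f).1 x = ∫ y, f.1 y ∂(κ ^ (k + 1)) x - ∫ y, f.1 y ∂m := by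
  induction k generalizing x with
  | zero => rw [zero_add, pow_one, pow_one]; rfl
  | succ k ih =>
    have hm := measurable_integral_kernel (κ ^ (k + 1)) f.2
    have hi : ∀ (p : Measure X) [IsProbabilityMeasure p],
        Integrable (fun x => ∫ y, f.1 y ∂(κ ^ (k + 1)) x) p := fun p _ =>
      integrable_of_forall_norm_le hm
        (fun x => norm_integral_le_of_forall_norm_le (norm_apply_le_norm f) _) p
    have hinvk : ∫ x, ∫ y, f.1 y ∂(κ ^ (k + 1)) x ∂m = ∫ y, f.1 y ∂m := by
      have : (κ ^ (k + 1)).Invariant m := by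
        clear ih hm hi
        induction k with
        | zero => simpa using hinv
        | succ k ih => rw [pow_succ]; exact ih.comp hinv
      exact integral_integral_kernel this (integrable_coe_bddMeas f m)
    rw [pow_succ' (centeredOp κ m), mul_apply_eq_comp, centeredOp_apply]
    simp only [ih]
    rw [integral_sub (hi _) (integrable_const _), integral_sub (hi _) (integrable_const _), hinvk,
      integral_const, integral_const, probReal_univ, probReal_univ, one_smul, sub_self, sub_zero,
      integral_kernel_pow_succ κ (k + 1) x (integrable_coe_bddMeas f _)]

theorem norm_centeredOp_pow_le (hinv : κ.Invariant m) (n : ℕ) : ‖centeredOp κ m ^ n‖ ≤ 2 := by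
  rcases n with _ | n
  · rw [pow_zero]
    exact ContinuousLinearMap.norm_id_le.trans one_le_two
  · refine ContinuousLinearMap.opNorm_le_bound _ zero_le_two fun f => ?_
    refine norm_le_of_forall_apply_le _ (by positivity) fun x => ?_
    rw [centeredOp_pow_apply hinv]
    exact norm_centered_le (κ ^ (n + 1)) m f x

/-- If all powers of the kernel have a unique invariant mean, the powers of the kernel converge in
operator norm. -/
theorem tendsto_norm_centeredOp_pow
    (hμ : ∀ d : ℕ, 1 ≤ d → Deltaba (κ ^ d) = {BA.ofMeasure m}) :
    Tendsto (fun n : ℕ => ‖centeredOp κ m ^ n‖) atTop (𝓝 0) := by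
  have hμ1 : Deltaba κ = {BA.ofMeasure m} := by rw [← Deltaba_pow_one]; exact hμ 1 le_rfl
  have hinv : κ.Invariant m := invariant_of_markovOp_eq (markovOp_eq_of_unique hμ1)
  obtain ⟨x₀⟩ : Nonempty X := m.nonempty_of_neZero
  have hnt : Nontrivial (BddMeasFun X) := by
    refine ⟨0, toBddMeas (fun _ => 1) measurable_const ⟨1, fun _ => by simp⟩, fun h => ?_⟩
    have : (0 : ℂ) = 1 := congrArg (fun f : BddMeasFun X => f.1 x₀) h
    exact zero_ne_one this
  by_contra hcon
  obtain ⟨z, hz, happ⟩ := exists_approximate_eigenvalue (centeredOp κ m)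
    (norm_centeredOp_pow_le hinv) hcon
  refine not_forall_exists_approximate_eigenfunction hμ hz fun ε hε => ?_
  obtain ⟨f, hf1, hSf⟩ := happ (ε / 2) (half_pos hε)
  have hfx : ∀ x, ‖f.1 x‖ ≤ 1 := fun x => (norm_apply_le_norm f x).trans_eq hf1
  have hSx : ∀ x, ‖∫ y, f.1 y ∂κ x - ∫ y, f.1 y ∂m - z * f.1 x‖ ≤ ε / 2 := fun x =>
    (norm_apply_le_norm (centeredOp κ m f - z • f) x).trans hSf.le
  have hPi : Integrable (fun x => ∫ y, f.1 y ∂κ x) m :=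
    integrable_of_forall_norm_le (measurable_integral_kernel κ f.2)
      (fun x => norm_integral_le_of_forall_norm_le hfx _) m
  have hfi := integrable_coe_bddMeas f m
  have hmean : ‖∫ x, f.1 x ∂m‖ ≤ ε / 2 := by
    have h1 := norm_integral_le_of_forall_norm_le hSx m
    have hci : Integrable (fun x => ∫ y, f.1 y ∂κ x - ∫ y, f.1 y ∂m) m :=
      hPi.sub (integrable_const _)
    rw [integral_sub hci (hfi.const_mul z),
      integral_sub hPi (integrable_const _), integral_integral_kernel hinv hfi, integral_const,
      probReal_univ, one_smul, sub_self, zero_sub, norm_neg, MeasureTheory.integral_const_mul,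
      norm_mul, hz, one_mul] at h1
    exact h1
  refine ⟨f.1, f.2, hfx, ?_, fun x => ?_, by linarith⟩
  · by_contra! h
    have h1 : ‖f‖ ≤ max (1 - ε) 0 :=
      norm_le_of_forall_apply_le f (le_max_right _ _) fun x => (h x).trans (le_max_left _ _)
    rw [hf1] at h1
    rcases le_max_iff.1 h1 with h2 | h2 <;> linarith
  · have h1 : ∫ y, f.1 y ∂κ x - z * f.1 x
        = (∫ y, f.1 y ∂κ x - ∫ y, f.1 y ∂m - z * f.1 x) + ∫ y, f.1 y ∂m := by ring
    rw [h1]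
    exact (norm_add_le _ _).trans (by linarith [hSx x])

/-! ### Uniform convergence of the iterates -/

theorem exists_forall_norm_pow_sub_lt {μ : BA X} (hμ : Deltaba κ = {μ}) (hs : IsSimple κ μ)
    {ε : ℝ} (hε : 0 < ε) :
    ∃ N : ℕ, ∀ n, N ≤ n → ∀ η ∈ Sba X, ‖(markovOp κ ^ n) η - μ‖ < ε := by
  obtain ⟨m, hm, rfl⟩ := exists_measure_of_unique hμ
  have hinv : κ.Invariant m := invariant_of_markovOp_eq (markovOp_eq_of_unique hμ)
  have hlim := tendsto_norm_centeredOp_pow fun d hd => Deltaba_pow_eq hμ hs hd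
  obtain ⟨N, hN⟩ := Metric.tendsto_atTop.1 hlim (ε / 4) (by positivity)
  refine ⟨N + 1, fun n hn η hη => ?_⟩
  have hnorm : ‖centeredOp κ m ^ n‖ ≤ ε / 4 := by
    have := hN n (by omega)
    rw [Real.dist_eq, sub_zero, abs_of_nonneg (norm_nonneg _)] at this
    exact this.le
  obtain ⟨k, rfl⟩ : ∃ k, n = k + 1 := ⟨n - 1, by omega⟩
  have hset : ∀ E, MeasurableSet E →
      |((markovOp κ ^ (k + 1)) η - BA.ofMeasure m) E| ≤ ε / 4 := fun E hE => by
    let g : BddMeasFun X := toBddMeas (E.indicator fun _ => 1)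
      (measurable_const.indicator hE) ⟨1, fun x => by by_cases hx : x ∈ E <;> simp [hx]⟩
    have hg1 : ‖g‖ ≤ 1 := norm_le_of_forall_apply_le g zero_le_one fun x => by
      change ‖E.indicator (fun _ => (1 : ℂ)) x‖ ≤ 1
      by_cases hx : x ∈ E <;> simp [hx]
    have hgi : ∀ (p : Measure X) [IsProbabilityMeasure p], ∫ x, g.1 x ∂p = (p.real E : ℂ) :=
      fun p _ => by
        change ∫ x, E.indicator (fun _ => (1 : ℂ)) x ∂p = _
        rw [MeasureTheory.integral_indicator hE, setIntegral_const]
        simp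
    have hx : ∀ x, |((κ ^ (k + 1)) x).real E - m.real E| ≤ ε / 4 := fun x => by
      have h1 := norm_apply_le_norm ((centeredOp κ m ^ (k + 1)) g) x
      rw [centeredOp_pow_apply hinv, hgi, hgi, ← Complex.ofReal_sub, Complex.norm_real,
        Real.norm_eq_abs] at h1
      refine h1.trans ((ContinuousLinearMap.le_opNorm _ g).trans ?_)
      calc _ ≤ ε / 4 * 1 := by gcongr
        _ = _ := mul_one _
    have hb := bddMeas_kernel_real (κ ^ (k + 1)) hE
    have h2 : ((markovOp κ ^ (k + 1)) η - BA.ofMeasure m) E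
        = η.integral fun x => ((κ ^ (k + 1)) x).real E - m.real E := by
      rw [BA.integral_sub _ hb (.const _), BA.integral_const, (mem_Sba_iff.1 hη).2, mul_one,
        BA.sub_apply, markovOp_pow_apply κ _ _ hE, BA.ofMeasure_apply m hE]
    rw [h2]
    refine (BA.abs_integral_le _ (hb.sub (.const _)).1 (by positivity) hx).trans_eq ?_
    rw [hη.2, mul_one]
  refine (BA.norm_le_of_forall_abs_apply_le _ hset).trans_lt ?_
  linarith

end GenMarkov

end

theorem theorem5p4 {X : Type*} [MeasurableSpace X]
    (κ : Kernel X X) [IsMarkovKernel κ]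
    (μ : BA X) (hμ : Deltaba κ = {μ}) :
    (∀ ε : ℝ, 0 < ε → ∃ N : ℕ, ∀ n : ℕ, N ≤ n → ∀ η ∈ Sca X,
      ‖cesaro κ n η - μ‖ < ε) ∧
    (IsSimple κ μ →
      ∀ ε : ℝ, 0 < ε → ∃ N : ℕ, ∀ n : ℕ, N ≤ n → ∀ η ∈ Sca X,
        ‖(markovOp κ ^ n) η - μ‖ < ε) := by
  refine ⟨fun ε hε => ?_, fun hs ε hε => ?_⟩
  · obtain ⟨N, hN⟩ := exists_forall_norm_cesaro_sub_lt hμ hε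
    exact ⟨N, fun n hn η hη => hN n hn η hη.1⟩
  · obtain ⟨N, hN⟩ := exists_forall_norm_pow_sub_lt hμ hs hε
    exact ⟨N, fun n hn η hη => hN n hn η hη.1⟩
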